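/- Let $m_1,m_2,k_1,k_2,\theta_1,\theta_2,\Omega_1,\Omega_2,p,\sigma_B,\sigma_E>0$ and $\rho\in[0,1)$, and write $(x)_n=x(x+1)\cdots(x+n-1)$. Let $w_1,w_2$ be independent Nakagami-$m$ random variables with shapes $m_1,m_2$ and average powers $\mathbb E\{w_\ell^2\}=\Omega_\ell$. Let $(b_1,b_2)$ be independent of $(w_1,w_2)$ and have the bivariate Gamma law with shapes $k_1,k_2$, scales $\theta_1,\theta_2$ and correlation parameter $\rho$, that is, the law with joint density $$f_{b_1,b_2}(y_1,y_2)=(1-\rho)^{k_2}\sum_{i,j=0}^{\infty}\frac{(k_1)_i(k_2-k_1)_j\,\rho^{i+j}}{i!\,j!}\;\phi_{k_1+i,\,\theta_1(1-\rho)}(y_1)\;\phi_{k_2+i+j,\,\theta_2(1-\rho)}(y_2),$$ where $\phi_{a,s}(y)=y^{a-1}e^{-y/s}/(\Gamma(a)s^a)$, $y>0$, is the Gamma density with shape $a$ and scale $s$ (the parameters are assumed to be such that this is a probability density; in particular $k_1\le k_2$ suffices). Put $g_B=\sqrt{b_1}\,w_1$, $g_E=\sqrt{b_2}\,w_2$,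 and let the signal-to-noise ratios at the legitimate receiver and at the eavesdropper be $\gamma_1=p\,g_B^2/\sigma_B^2$ and $\gamma_2=p\,g_E^2/\sigma_E^2$, with averages $\overline\gamma_1=p\,\mathbb E\{g_B^2\}/\sigma_B^2$ and $\overline\gamma_2=p\,\mathbb E\{g_E^2\}/\sigma_E^2$. Let $P_{\rm o}(r)=1-\Pr[\gamma_1>2^r(1+\gamma_2)-1]$. Then $P_{\rm o}(0)=\Pr[\gamma_1\le\gamma_2]$ and $$P_{\rm o}(0)=\frac{(1-\rho)^{k_2}}{\Gamma(m_1)\Gamma(m_2)}\sum_{i,j=0}^{\infty}\frac{(k_1)_i(k_2-k_1)_j\,\rho^{i+j}}{i!\,j!\,(i+k_2)_j\,\Gamma(i+k_1)\,\Gamma(i+k_2)}\;G^{2,3}_{3,3}\!\left[\frac{m_1k_1\overline\gamma_2}{m_2k_2\overline\gamma_1}\,\middle|\,\begin{matrix}1,\;1-m_2,\;1-i-j-k_2\\ i+k_1,\;m_1,\;0\end{matrix}\right],$$ where $G$ is Meijer's G-function, the double series converges absolutely, and each G-function is given by its defining Mellin–Barnes integral along a vertical line separating the two families of poles, which converges absolutely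 along every such line. -/

import Mathlib

open MeasureTheory ProbabilityTheory

noncomputable section

/-- Pochhammer's symbol `(x)_n = x (x + 1) ⋯ (x + n - 1)`, which is `Γ(x + n) / Γ(x)` whenever `x`
is not a pole of `Γ`. -/
def pochhammerSymbol (x : ℝ) (n : ℕ) : ℝ := (ascPochhammer ℝ n).eval x

/-! ### Distributions -/

/-- Density of the Nakagami-`m` distribution with shape `m` and average power `Ω = 𝔼[w ^ 2]`. -/
def nakagamiPDFReal (m Ω x : ℝ) : ℝ :=
  if 0 ≤ x then
    2 * m ^ m / (Real.Gamma m * Ω ^ m) * x ^ (2 * m - 1) * Real.exp (-(m * x ^ 2 / Ω))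
  else 0

/-- The Nakagami-`m` distribution. -/
def nakagamiMeasure (m Ω : ℝ) : Measure ℝ :=
  volume.withDensity fun x => ENNReal.ofReal (nakagamiPDFReal m Ω x)

/-- Density of the bivariate Gamma distribution with shapes `k₁`, `k₂`, scales `θ₁`, `θ₂` and
correlation parameter `ρ`. Here `gammaPDFReal a r` is the Gamma density with shape `a` and
rate `r`. The marginals are the Gamma laws with shape `k_ℓ` and scale `θ_ℓ`, and the
Laplace transform is
`(1 + θ₂ s₂) ^ (k₁ - k₂) * ((1 + θ₁ s₁) * (1 + θ₂ s₂) - ρ θ₁ θ₂ s₁ s₂) ^ (-k₁)`. -/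
def bivariateGammaPDFReal (k₁ k₂ θ₁ θ₂ ρ y₁ y₂ : ℝ) : ℝ :=
  (1 - ρ) ^ k₂ * ∑' ij : ℕ × ℕ,
    pochhammerSymbol k₁ ij.1 * pochhammerSymbol (k₂ - k₁) ij.2 * ρ ^ (ij.1 + ij.2)
        / (ij.1.factorial * ij.2.factorial)
      * gammaPDFReal (k₁ + ij.1) (1 / (θ₁ * (1 - ρ))) y₁
      * gammaPDFReal (k₂ + ij.1 + ij.2) (1 / (θ₂ * (1 - ρ))) y₂

/-- The bivariate Gamma distribution. -/
def bivariateGammaMeasure (k₁ k₂ θ₁ θ₂ ρ : ℝ) : Measure (ℝ × ℝ) :=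
  volume.withDensity fun y =>
    ENNReal.ofReal (bivariateGammaPDFReal k₁ k₂ θ₁ θ₂ ρ y.1 y.2)

/-! ### Signal-to-noise ratios and the secrecy outage probability -/

/-- Amplitude `√b * w` of a channel gain with shadowing `b` and small-scale fading `w`. -/
def channelAmplitude {S : Type*} (b w : S → ℝ) : S → ℝ := fun ω => √(b ω) * w ω

/-- Instantaneous received SNR for transmit power `p`, noise variance `σ ^ 2`, amplitude `g`. -/
def snr {S : Type*} (p σ : ℝ) (g : S → ℝ) : S → ℝ := fun ω => p * g ω ^ 2 / σ ^ 2

/-- Average received SNR `p 𝔼[g ^ 2] / σ ^ 2`. -/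
def averageSNR {S : Type*} [MeasurableSpace S] (P : Measure S) (p σ : ℝ) (g : S → ℝ) : ℝ :=
  p * (∫ ω, g ω ^ 2 ∂P) / σ ^ 2

/-- Secrecy outage probability at the target secrecy rate `r`. -/
def secrecyOutage {S : Type*} [MeasurableSpace S] (P : Measure S) (γ₁ γ₂ : S → ℝ) (r : ℝ) : ℝ :=
  1 - P.real {ω | γ₁ ω > 2 ^ r * (1 + γ₂ ω) - 1}

/-! ### The Meijer G-function -/

/-- The integrand of `G^{m,n}_{p,q}[z | a; b]`:
`(∏_{j ≤ m} Γ(b_j - s)) (∏_{j ≤ n} Γ(1 - a_j + s)) z ^ s`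
`/ ((∏_{j > m} Γ(1 - b_j + s)) (∏_{j > n} Γ(a_j - s)))`. -/
def meijerIntegrand {p q : ℕ} (m n : ℕ) (a : Fin p → ℂ) (b : Fin q → ℂ) (z s : ℂ) : ℂ :=
  (∏ j : Fin q, if (j : ℕ) < m then Complex.Gamma (b j - s) else (Complex.Gamma (1 - b j + s))⁻¹)
    * (∏ j : Fin p, if (j : ℕ) < n then Complex.Gamma (1 - a j + s) else (Complex.Gamma (a j - s))⁻¹)
    * z ^ s

/-- The line `Re s = c` has all poles of `Γ(b_j - s)`, `j ≤ m`, to its right and all poles of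
`Γ(1 - a_j + s)`, `j ≤ n`, to its left. -/
def MeijerSeparates {p q : ℕ} (m n : ℕ) (a : Fin p → ℂ) (b : Fin q → ℂ) (c : ℝ) : Prop :=
  (∀ j : Fin q, (j : ℕ) < m → c < (b j).re) ∧ (∀ j : Fin p, (j : ℕ) < n → (a j).re - 1 < c)

/-- A vertical line separates the two families of poles, and the defining integral converges
absolutely along every such line. -/
def MeijerGConverges {p q : ℕ} (m n : ℕ) (a : Fin p → ℂ) (b : Fin q → ℂ) (z : ℂ) : Prop :=
  (∃ c, MeijerSeparates m n a b c) ∧ ∀ c, MeijerSeparates m n a b c →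
    Integrable fun t : ℝ => meijerIntegrand m n a b z (c + t * Complex.I)

open Classical in
/-- The Meijer G-function `G^{m,n}_{p,q}[z | a; b] = (2πi)⁻¹ ∫_L (integrand) ds`, where `L` is a
vertical line from `c - i∞` to `c + i∞` that separates the poles (so `ds = i dt`); the value is
only meaningful when `MeijerGConverges` holds, and then it does not depend on the line. (Parameters
for which only an indented contour separates the poles get the value `0`.) -/
def meijerG {p q : ℕ} (m n : ℕ) (a : Fin p → ℂ) (b : Fin q → ℂ) (z : ℂ) : ℂ :=
  if h : ∃ c, MeijerSeparates m n a b c then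
    (2 * Real.pi : ℂ)⁻¹ * ∫ t : ℝ, meijerIntegrand m n a b z (h.choose + t * Complex.I)
  else 0

end

/-! The bivariate Gamma density is a series, with weights `(1 - ρ) ^ k₂ * mixtureWeight k₁ k₂ ρ ij`,
of densities of independent Gamma pairs. By the binomial series the weights are absolutely summable
with sum 1, so the probability of any event is the absolutely convergent weighted sum of its
probabilities under the components (`hasSum_measureReal_bivariateGammaMeasure_prod`). For `k₂ < k₁`
the weights may change sign, and `ENNReal.ofReal` truncates the density; but if the truncation has
total mass 1, then, as the untruncated series also integrates to 1, its negative part vanishes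
almost everywhere (`ae_nonneg_mixture`).

Squares of Nakagami variables are Gamma, so within a component the outage event reads `σE ^ 2 / σB ^
2 ≤ V`, where `V = y₂ u₂ / (y₁ u₁)` is built from four independent Gamma variables. The Mellin
transform of the tail of `V` is `𝔼[V ^ s] / s`. The moment is a product of four Gamma functions and
an exponential in `s`, and `1 / s = Γ(s) / Γ(1 + s)`, which is exactly the integrand of
`G^{2,3}_{3,3}`; Mellin inversion gives `measureReal_le_gainRatio`. The means `k_ℓ θ_ℓ Ω_ℓ` of the
squared gains then turn the argument into the ratio of average SNRs. -/

/-! ### Binomial series and moments of the mixture weights -/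

lemma pochhammerSymbol_succ (a : ℝ) (n : ℕ) :
    pochhammerSymbol a (n + 1) = pochhammerSymbol a n * (a + n) := by
  simp [pochhammerSymbol, ascPochhammer_succ_eval]

lemma pochhammerSymbol_succ_left (a : ℝ) (n : ℕ) :
    pochhammerSymbol a (n + 1) = a * pochhammerSymbol (a + 1) n := by
  simp [pochhammerSymbol, ascPochhammer_succ_left, Polynomial.eval_comp]

lemma hasSum_pochhammerSymbol (a : ℝ) {x : ℝ} (hx : |x| < 1) :
    HasSum (fun n : ℕ => pochhammerSymbol a n * x ^ n / n.factorial) ((1 - x) ^ (-a)) := by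
  have h := (Real.one_div_one_sub_rpow_hasFPowerSeriesOnBall_zero a).hasSum (y := x) (by
    simpa [Metric.mem_eball, enorm_eq_nnnorm, ← NNReal.coe_lt_coe] using hx)
  simp only [zero_add] at h
  convert! h using 1
  · funext n
    rw [FormalMultilinearSeries.ofScalars_apply_eq, smul_eq_mul]
    -- The power series has coefficients `Ring.choose (a + n - 1) n`, a multichoose number, and `n!`
    -- times it is the rising factorial.
    have h1 := Ring.factorial_nsmul_multichoose_eq_ascPochhammer a n
    rw [Ring.choose, show a + n - 1 - n + 1 = a by ring]
    rw [Polynomial.ascPochhammer_smeval_eq_eval, nsmul_eq_mul] at h1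
    rw [pochhammerSymbol, ← h1]
    field_simp
  · rw [Real.rpow_neg (by linarith [(abs_lt.mp hx).2]), one_div]

/-- `∑ n (a)_n x ^ n / n! = a x (1 - x) ^ (-a - 1)` -/
lemma hasSum_nat_mul_pochhammerSymbol (a : ℝ) {x : ℝ} (hx : |x| < 1) :
    HasSum (fun n : ℕ => (n : ℝ) * (pochhammerSymbol a n * x ^ n / n.factorial))
      (a * x * (1 - x) ^ (-(a + 1))) := by
  rw [← hasSum_nat_add_iff' 1]
  convert! (hasSum_pochhammerSymbol (a + 1) hx).mul_left (a * x) using 1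
  · funext n
    rw [pochhammerSymbol_succ_left, Nat.factorial_succ]
    push_cast
    field_simp
    ring
  · simp

/-- The coefficients of the bivariate Gamma density. -/
noncomputable def mixtureWeight (k₁ k₂ ρ : ℝ) (ij : ℕ × ℕ) : ℝ :=
  pochhammerSymbol k₁ ij.1 * pochhammerSymbol (k₂ - k₁) ij.2 * ρ ^ (ij.1 + ij.2)
    / (ij.1.factorial * ij.2.factorial)

/-- Separating the indices reduces every double series of weights to a product of two binomial-type
series. -/
lemma mixtureWeight_eq (k₁ k₂ ρ : ℝ) (ij : ℕ × ℕ) :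
    mixtureWeight k₁ k₂ ρ ij = (pochhammerSymbol k₁ ij.1 * ρ ^ ij.1 / ij.1.factorial) *
      (pochhammerSymbol (k₂ - k₁) ij.2 * ρ ^ ij.2 / ij.2.factorial) := by
  rw [mixtureWeight, pow_add]; field_simp

lemma hasSum_prod_mul_of_hasSum {f g : ℕ → ℝ} {a b : ℝ} (hf : HasSum f a) (hg : HasSum g b) :
    HasSum (fun ij : ℕ × ℕ => f ij.1 * g ij.2) (a * b) :=
  hf.mul hg (summable_mul_of_summable_norm hf.summable.norm hg.summable.norm)

section
variable {k₁ k₂ ρ : ℝ}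

/-- The exponents `-k₁` and `-(k₂ - k₁)` add up to `-k₂`, whence the normalising factor `(1 - ρ) ^
k₂`. -/
lemma hasSum_mixtureWeight (hρ₀ : 0 ≤ ρ) (hρ₁ : ρ < 1) :
    HasSum (mixtureWeight k₁ k₂ ρ) ((1 - ρ) ^ (-k₂)) := by
  have hρ : |ρ| < 1 := by rwa [abs_of_nonneg hρ₀]
  have h := hasSum_prod_mul_of_hasSum (hasSum_pochhammerSymbol k₁ hρ)
    (hasSum_pochhammerSymbol (k₂ - k₁) hρ)
  rw [← Real.rpow_add (by linarith)] at h
  convert! h using 1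
  · exact funext (mixtureWeight_eq k₁ k₂ ρ)
  · congr 1; ring

lemma hasSum_mixtureWeight_mul_fst (hρ₀ : 0 ≤ ρ) (hρ₁ : ρ < 1) :
    HasSum (fun ij => mixtureWeight k₁ k₂ ρ ij * (ij.1 : ℝ))
      (k₁ * ρ * (1 - ρ) ^ (-k₂ - 1)) := by
  have hρ : |ρ| < 1 := by rwa [abs_of_nonneg hρ₀]
  have h := hasSum_prod_mul_of_hasSum (hasSum_nat_mul_pochhammerSymbol k₁ hρ)
    (hasSum_pochhammerSymbol (k₂ - k₁) hρ)
  rw [mul_assoc, ← Real.rpow_add (by linarith)] at h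
  convert! h using 1
  · funext ij; rw [mixtureWeight_eq]; ring
  · congr 2; ring

lemma hasSum_mixtureWeight_mul_snd (hρ₀ : 0 ≤ ρ) (hρ₁ : ρ < 1) :
    HasSum (fun ij => mixtureWeight k₁ k₂ ρ ij * (ij.2 : ℝ))
      ((k₂ - k₁) * ρ * (1 - ρ) ^ (-k₂ - 1)) := by
  have hρ : |ρ| < 1 := by rwa [abs_of_nonneg hρ₀]
  have h := hasSum_prod_mul_of_hasSum (hasSum_pochhammerSymbol k₁ hρ)
    (hasSum_nat_mul_pochhammerSymbol (k₂ - k₁) hρ)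
  rw [mul_left_comm, ← Real.rpow_add (by linarith)] at h
  convert! h using 1
  · funext ij; rw [mixtureWeight_eq]; ring
  · congr 2; ring

/-- Mean of the first shape parameter `k₁ + i`. -/
lemma hasSum_mixtureWeight_mul_shape_fst (hρ₀ : 0 ≤ ρ) (hρ₁ : ρ < 1) :
    HasSum (fun ij => mixtureWeight k₁ k₂ ρ ij * (k₁ + ij.1)) (k₁ * (1 - ρ) ^ (-k₂ - 1)) := by
  have h := ((hasSum_mixtureWeight (k₁ := k₁) (k₂ := k₂) hρ₀ hρ₁).mul_right k₁).add
    (hasSum_mixtureWeight_mul_fst (k₁ := k₁) (k₂ := k₂) hρ₀ hρ₁)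
  convert! h using 1
  · funext ij; ring
  · rw [Real.rpow_sub_one (by linarith)]
    have : 1 - ρ ≠ 0 := by linarith
    field_simp
    ring

/-- Mean of the second shape parameter `k₂ + i + j`. -/
lemma hasSum_mixtureWeight_mul_shape_snd (hρ₀ : 0 ≤ ρ) (hρ₁ : ρ < 1) :
    HasSum (fun ij => mixtureWeight k₁ k₂ ρ ij * (k₂ + ij.1 + ij.2))
      (k₂ * (1 - ρ) ^ (-k₂ - 1)) := by
  have h := (((hasSum_mixtureWeight (k₁ := k₁) (k₂ := k₂) hρ₀ hρ₁).mul_right k₂).add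
    (hasSum_mixtureWeight_mul_fst (k₁ := k₁) (k₂ := k₂) hρ₀ hρ₁)).add
    (hasSum_mixtureWeight_mul_snd (k₁ := k₁) (k₂ := k₂) hρ₀ hρ₁)
  convert! h using 1
  · funext ij; ring
  · rw [Real.rpow_sub_one (by linarith)]
    have : 1 - ρ ≠ 0 := by linarith
    field_simp
    ring

end

/-! ### Gamma and Nakagami laws -/

lemma integral_gammaMeasure {E : Type*} [NormedAddCommGroup E] [NormedSpace ℝ E] {a r : ℝ}
    (ha : 0 < a) (hr : 0 < r) (g : ℝ → E) :
    ∫ x, g x ∂gammaMeasure a r = ∫ x in Set.Ioi 0, gammaPDFReal a r x • g x := by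
  rw [gammaMeasure, integral_withDensity_eq_integral_toReal_smul
    (by unfold gammaPDF; fun_prop) (by simp [gammaPDF])]
  rw [← integral_Ici_eq_integral_Ioi, ← integral_indicator measurableSet_Ici]
  congr 1 with x
  by_cases hx : 0 ≤ x
  · simp [hx, gammaPDF, ENNReal.toReal_ofReal (gammaPDFReal_nonneg ha hr x)]
  · simp [hx, gammaPDF_of_neg (not_le.mp hx)]

lemma ae_pos_gammaMeasure (a r : ℝ) : ∀ᵐ x ∂gammaMeasure a r, 0 < x := by
  rw [gammaMeasure, ae_withDensity_iff (by unfold gammaPDF; fun_prop)]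
  filter_upwards [Measure.ae_ne volume (0 : ℝ)] with x hx h
  by_contra! hneg
  exact h (gammaPDF_of_neg (lt_of_le_of_ne hneg hx))

instance nullSingletonClass_gammaMeasure (a r : ℝ) : NullSingletonClass (gammaMeasure a r) :=
  ⟨fun x => withDensity_absolutelyContinuous _ _ (measure_singleton x)⟩

lemma integral_cpow_gammaMeasure {a r : ℝ} (ha : 0 < a) (hr : 0 < r) {s : ℂ} (hs : 0 < a + s.re) :
    ∫ x : ℝ, (x : ℂ) ^ s ∂gammaMeasure a r
      = Complex.Gamma (a + s) / Real.Gamma a * (r : ℂ) ^ (-s) := by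
  have hr' : (r : ℂ) ≠ 0 := by exact_mod_cast hr.ne'
  rw [integral_gammaMeasure ha hr]
  calc ∫ x in Set.Ioi (0 : ℝ), gammaPDFReal a r x • (x : ℂ) ^ s
      = ∫ x in Set.Ioi (0 : ℝ), ((r ^ a / Real.Gamma a : ℝ) : ℂ) *
          ((x : ℂ) ^ ((a + s : ℂ) - 1) * Complex.exp (-(r * x))) := by
        refine setIntegral_congr_fun measurableSet_Ioi fun x (hx : 0 < x) => ?_
        have hx' : (x : ℂ) ≠ 0 := by exact_mod_cast hx.ne'
        simp only [gammaPDFReal, if_pos hx.le, Complex.real_smul]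
        rw [show (a + s : ℂ) - 1 = ((a - 1 : ℝ) : ℂ) + s by push_cast; ring,
          Complex.cpow_add _ _ hx']
        push_cast [Complex.ofReal_cpow hx.le]
        ring
    _ = _ := by
        rw [integral_const_mul, Complex.integral_cpow_mul_exp_neg_mul_Ioi (by simpa using hs) hr,
          one_div, Complex.inv_cpow _ _ (by
            simp [Complex.arg_ofReal_of_nonneg hr.le, Real.pi_ne_zero.symm]),
          Complex.cpow_add _ _ hr', Complex.cpow_neg]
        push_cast [Complex.ofReal_cpow hr.le]
        have h1 : (r : ℂ) ^ (a : ℂ) ≠ 0 := by simp [hr', Complex.cpow_eq_zero_iff]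
        field_simp

/-- A non-integrable function has Bochner integral 0 by convention, whereas the moment formula gives
a nonzero value. -/
lemma integrable_rpow_gammaMeasure {a r c : ℝ} (ha : 0 < a) (hr : 0 < r) (hc : 0 < a + c) :
    Integrable (fun x : ℝ => x ^ c) (gammaMeasure a r) := by
  have h := integral_cpow_gammaMeasure ha hr (s := c) (by simpa using hc)
  have h1 : Integrable (fun x : ℝ => (x : ℂ) ^ (c : ℂ)) (gammaMeasure a r) := by
    by_contra hn
    rw [integral_undef hn] at h
    have h2 : Complex.Gamma (a + c) ≠ 0 := by
      rw [← Complex.ofReal_add, Complex.Gamma_ofReal]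
      exact_mod_cast (Real.Gamma_pos_of_pos hc).ne'
    have h3 : (Real.Gamma a : ℂ) ≠ 0 := by exact_mod_cast (Real.Gamma_pos_of_pos ha).ne'
    have h4 : (r : ℂ) ≠ 0 := by exact_mod_cast hr.ne'
    have h5 : Complex.Gamma (a + c) / Real.Gamma a * (r : ℂ) ^ (-c : ℂ) ≠ 0 := by
      simp [h2, h3, h4, Complex.cpow_eq_zero_iff]
    exact h5 h.symm
  refine h1.norm.congr ?_
  filter_upwards [ae_pos_gammaMeasure a r] with x hx
  rw [Complex.norm_cpow_eq_rpow_re_of_pos hx, Complex.ofReal_re]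

lemma integrable_id_gammaMeasure {a r : ℝ} (ha : 0 < a) (hr : 0 < r) :
    Integrable (fun x : ℝ => x) (gammaMeasure a r) := by
  simpa using integrable_rpow_gammaMeasure ha hr (c := 1) (by linarith)

lemma integral_id_gammaMeasure {a r : ℝ} (ha : 0 < a) (hr : 0 < r) :
    ∫ x, x ∂gammaMeasure a r = a / r := by
  have h := integral_cpow_gammaMeasure ha hr (s := 1) (by simp; linarith)
  simp only [Complex.cpow_one] at h
  rw [integral_complex_ofReal] at h
  have ha' : (a : ℂ) ≠ 0 := by exact_mod_cast ha.ne'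
  have hr' : (r : ℂ) ≠ 0 := by exact_mod_cast hr.ne'
  have h3 : (Real.Gamma a : ℂ) ≠ 0 := by exact_mod_cast (Real.Gamma_pos_of_pos ha).ne'
  rw [Complex.Gamma_add_one _ ha', Complex.Gamma_ofReal, Complex.cpow_neg_one] at h
  have h' : ((∫ x, x ∂gammaMeasure a r : ℝ) : ℂ) = ((a / r : ℝ) : ℂ) := by
    rw [h]; push_cast; field_simp
  exact_mod_cast h'

/-- The square of a Nakagami variable has a Gamma law. -/
lemma map_sq_nakagamiMeasure {m Ω : ℝ} (hm : 0 < m) (hΩ : 0 < Ω) :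
    (nakagamiMeasure m Ω).map (fun x => x ^ 2) = gammaMeasure m (m / Ω) := by
  have hmeas : Measurable (fun x : ℝ => x ^ 2) := by fun_prop
  have himg : (fun x : ℝ => x ^ 2) '' Set.Ioi 0 = Set.Ioi 0 := by
    ext y
    constructor
    · rintro ⟨x, hx, rfl⟩
      exact pow_pos (Set.mem_Ioi.mp hx) 2
    · intro hy
      exact ⟨√y, Real.sqrt_pos.mpr hy, Real.sq_sqrt (le_of_lt hy)⟩
  -- Both densities vanish on the negative axis, so the change of variables is needed only on
  -- `Set.Ioi 0`, where squaring is injective.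
  have hpos : ∀ f : ℝ → ENNReal, (∀ x < 0, f x = 0) → ∫⁻ x, f x = ∫⁻ x in Set.Ioi 0, f x := by
    intro f hf
    rw [← lintegral_indicator measurableSet_Ioi]
    refine lintegral_congr_ae ?_
    filter_upwards [Measure.ae_ne volume (0 : ℝ)] with x hx
    rcases lt_or_gt_of_ne hx with h | h
    · simp [hf x h, not_lt.mpr h.le]
    · simp [Set.mem_Ioi.mpr h]
  refine Measure.ext_of_lintegral _ fun f hf => ?_
  have hnak : Measurable fun x => ENNReal.ofReal (nakagamiPDFReal m Ω x) := by
    refine (Measurable.ite measurableSet_Ici ?_ measurable_const).ennreal_ofReal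
    fun_prop
  rw [lintegral_map hf hmeas, gammaMeasure, nakagamiMeasure,
    lintegral_withDensity_eq_lintegral_mul _ (by unfold gammaPDF; fun_prop) hf,
    lintegral_withDensity_eq_lintegral_mul _ hnak (g := fun x => f (x ^ 2)) (hf.comp hmeas), hpos, hpos]
  · conv_rhs => rw [← himg]
    rw [lintegral_image_eq_lintegral_abs_deriv_mul measurableSet_Ioi
      (f' := fun x => 2 * x) (fun x _ => by simpa using (hasDerivAt_pow 2 x).hasDerivWithinAt)
      (fun x hx y hy h => by
        exact (pow_left_inj₀ (le_of_lt hx) (le_of_lt hy) two_ne_zero).mp h)]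
    refine setLIntegral_congr_fun measurableSet_Ioi fun x (hx : 0 < x) => ?_
    simp only [Pi.mul_apply, ← mul_assoc]
    congr 1
    rw [gammaPDF, ← ENNReal.ofReal_mul (abs_nonneg _)]
    congr 1
    rw [nakagamiPDFReal, gammaPDFReal, if_pos hx.le, if_pos (sq_nonneg x), abs_of_pos (by positivity),
      Real.div_rpow hm.le hΩ.le, ← Real.rpow_natCast_mul hx.le,
      show 2 * m - 1 = ((2 : ℕ) : ℝ) * (m - 1) + 1 by push_cast; ring, Real.rpow_add_one hx.ne']
    have : -(m * x ^ 2 / Ω) = -(m / Ω * x ^ 2) := by ring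
    rw [this]
    have := (Real.Gamma_pos_of_pos hm).ne'
    have := (Real.rpow_pos_of_pos hΩ m).ne'
    field_simp
  · intro x hx
    simp [gammaPDF_of_neg hx]
  · intro x hx
    simp [nakagamiPDFReal, not_le.mpr hx]

/-! ### Tail probabilities by Mellin inversion -/

lemma setIntegral_Ioi_ite_cpow {v : ℝ} (hv : 0 < v) {s : ℂ} (hs : 0 < s.re) :
    ∫ x : ℝ in Set.Ioi 0, (if x ≤ v then (x : ℂ) ^ (s - 1) else 0) = (v : ℂ) ^ s / s := by
  have h : (fun x : ℝ => if x ≤ v then (x : ℂ) ^ (s - 1) else 0)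
      = (Set.Iic v).indicator fun x : ℝ => (x : ℂ) ^ (s - 1) := by
    ext x; simp [Set.indicator_apply]
  have hs0 : s ≠ 0 := by rintro rfl; simp at hs
  rw [h, setIntegral_indicator measurableSet_Iic, Set.Ioi_inter_Iic,
    ← intervalIntegral.integral_of_le hv.le, integral_cpow (Or.inl (by simpa using hs))]
  simp [hs0]

/-- Again a nonzero integral excludes the default value 0. -/
lemma integrableOn_Ioi_ite_cpow {v : ℝ} (hv : 0 < v) {s : ℂ} (hs : 0 < s.re) :
    IntegrableOn (fun x : ℝ => if x ≤ v then (x : ℂ) ^ (s - 1) else 0) (Set.Ioi 0) := by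
  by_contra hn
  have h := setIntegral_Ioi_ite_cpow hv hs
  rw [integral_undef hn] at h
  have hs0 : s ≠ 0 := by rintro rfl; simp at hs
  have hv0 : (v : ℂ) ≠ 0 := by exact_mod_cast hv.ne'
  exact div_ne_zero (by simp [hv0, Complex.cpow_eq_zero_iff]) hs0 h.symm

lemma setIntegral_Ioi_norm_ite_cpow {v : ℝ} (hv : 0 < v) {s : ℂ} (hs : 0 < s.re) :
    ∫ x : ℝ in Set.Ioi 0, ‖(if x ≤ v then (x : ℂ) ^ (s - 1) else 0)‖ = v ^ s.re / s.re := by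
  have h := setIntegral_Ioi_ite_cpow hv (s := (s.re : ℂ)) (by simpa using hs)
  rw [← Complex.ofReal_inj, ← integral_complex_ofReal]
  push_cast [Complex.ofReal_cpow hv.le]
  rw [← h]
  refine setIntegral_congr_fun measurableSet_Ioi fun x (hx : 0 < x) => ?_
  split_ifs
  · rw [Complex.norm_cpow_eq_rpow_re_of_pos hx]
    push_cast [Complex.ofReal_cpow hx.le]
    simp
  · simp

lemma integral_ite_le_const {S : Type*} [MeasurableSpace S] {Q : Measure S} {V : S → ℝ}
    (hV : Measurable V) (x : ℝ) (c : ℂ) :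
    ∫ ω, (if x ≤ V ω then c else 0) ∂Q = c * (Q.real {ω | x ≤ V ω} : ℂ) := by
  have hm : MeasurableSet {ω | x ≤ V ω} := measurableSet_le measurable_const hV
  have : (fun ω => if x ≤ V ω then c else 0) = {ω | x ≤ V ω}.indicator fun _ => c := by
    ext ω; simp [Set.indicator_apply]
  rw [this, integral_indicator hm, setIntegral_const, mul_comm, Complex.real_smul]

section
variable {S : Type*} [MeasurableSpace S] {Q : Measure S} [IsProbabilityMeasure Q] {V : S → ℝ}

/-- Integrating the norm in `x` first leaves `V ^ s.re / s.re`, which is integrable by hypothesis.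
This licenses Fubini in the Mellin transform of the tail. -/
lemma integrable_prod_ite_cpow (hV : Measurable V) (hpos : ∀ᵐ ω ∂Q, 0 < V ω) {s : ℂ}
    (hs : 0 < s.re) (hint : Integrable (fun ω => V ω ^ s.re) Q) :
    Integrable (fun z : ℝ × S => if z.1 ≤ V z.2 then (z.1 : ℂ) ^ (s - 1) else 0)
      ((volume.restrict (Set.Ioi 0)).prod Q) := by
  rw [integrable_prod_iff']
  · constructor
    · filter_upwards [hpos] with ω hω using integrableOn_Ioi_ite_cpow hω hs
    · refine (hint.div_const s.re).congr ?_
      filter_upwards [hpos] with ω hω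
      rw [← setIntegral_Ioi_norm_ite_cpow hω hs]
  · refine Measurable.aestronglyMeasurable (Measurable.ite ?_ ?_ measurable_const)
    · exact measurableSet_le measurable_fst (hV.comp measurable_snd)
    · exact (Complex.measurable_ofReal.comp measurable_fst).pow_const _

lemma mellinConvergent_measureReal_le (hV : Measurable V) (hpos : ∀ᵐ ω ∂Q, 0 < V ω) {s : ℂ}
    (hs : 0 < s.re) (hint : Integrable (fun ω => V ω ^ s.re) Q) :
    MellinConvergent (fun x => (Q.real {ω | x ≤ V ω} : ℂ)) s := by
  have h := (integrable_prod_ite_cpow hV hpos hs hint).integral_prod_left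
  simp only [integral_ite_le_const hV] at h
  exact h

lemma mellin_measureReal_le (hV : Measurable V) (hpos : ∀ᵐ ω ∂Q, 0 < V ω) {s : ℂ}
    (hs : 0 < s.re) (hint : Integrable (fun ω => V ω ^ s.re) Q) :
    mellin (fun x => (Q.real {ω | x ≤ V ω} : ℂ)) s = (∫ ω, (V ω : ℂ) ^ s ∂Q) / s := by
  have h := integral_integral_swap
    (f := fun (x : ℝ) (ω : S) => if x ≤ V ω then (x : ℂ) ^ (s - 1) else 0)
    (integrable_prod_ite_cpow hV hpos hs hint)
  simp only [integral_ite_le_const hV] at h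
  simp only [mellin, smul_eq_mul]
  rw [h, ← integral_div]
  refine integral_congr_ae ?_
  filter_upwards [hpos] with ω hω using setIntegral_Ioi_ite_cpow hω hs

/-- Pointwise Mellin inversion needs continuity at the point. Off the null event `V = x₀` the
indicator is locally constant in `x`, and dominated convergence applies. -/
lemma continuousAt_measureReal_le (hV : Measurable V) {x₀ : ℝ} (h₀ : Q {ω | V ω = x₀} = 0) :
    ContinuousAt (fun x => (Q.real {ω | x ≤ V ω} : ℂ)) x₀ := by
  have h : (fun x => (Q.real {ω | x ≤ V ω} : ℂ))
      = fun x => ∫ ω, (if x ≤ V ω then (1 : ℂ) else 0) ∂Q := by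
    ext x; simp [integral_ite_le_const hV]
  rw [h]
  refine continuousAt_of_dominated (bound := fun _ => 1) (.of_forall fun x => ?_)
    (.of_forall fun x => .of_forall fun ω => ?_) (integrable_const _) ?_
  · exact (Measurable.ite (measurableSet_le measurable_const hV) measurable_const
      measurable_const).aestronglyMeasurable
  · split_ifs <;> simp
  · have h₀' : ∀ᵐ ω ∂Q, V ω ≠ x₀ := by simpa [ae_iff] using h₀
    filter_upwards [h₀'] with ω hω
    rcases lt_or_gt_of_ne hω with h | h
    · refine continuousAt_const.congr (f := fun _ => (0 : ℂ)) ?_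
      filter_upwards [lt_mem_nhds h] with x hx
      rw [if_neg (not_le.mpr hx)]
    · refine continuousAt_const.congr (f := fun _ => (1 : ℂ)) ?_
      filter_upwards [gt_mem_nhds h] with x hx
      rw [if_pos hx.le]

/-- The tail probability of a positive random variable as an inverse Mellin transform of its
moments. -/
lemma measureReal_le_eq_integral_cpow (hV : Measurable V) (hpos : ∀ᵐ ω ∂Q, 0 < V ω) {c : ℝ}
    (hc : 0 < c) (hint : Integrable (fun ω => V ω ^ c) Q) {x : ℝ} (hx : 0 < x)
    (h₀ : Q {ω | V ω = x} = 0)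
    (hvert : Integrable fun t : ℝ =>
      (∫ ω, (V ω : ℂ) ^ (c + t * Complex.I) ∂Q) / (c + t * Complex.I)) :
    (Q.real {ω | x ≤ V ω} : ℂ) = (2 * Real.pi : ℂ)⁻¹ * ∫ t : ℝ,
      (x : ℂ) ^ (-(c + t * Complex.I)) *
        ((∫ ω, (V ω : ℂ) ^ (c + t * Complex.I) ∂Q) / (c + t * Complex.I)) := by
  have hm : ∀ t : ℝ, mellin (fun x => (Q.real {ω | x ≤ V ω} : ℂ)) (c + t * Complex.I)
      = (∫ ω, (V ω : ℂ) ^ (c + t * Complex.I) ∂Q) / (c + t * Complex.I) := fun t =>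
    mellin_measureReal_le hV hpos (by simpa using hc) (by simpa using hint)
  have h := mellinInv_mellin_eq c (fun x => (Q.real {ω | x ≤ V ω} : ℂ)) hx
    (mellinConvergent_measureReal_le hV hpos (by simpa using hc) (by simpa using hint))
    (by simpa only [Complex.VerticalIntegrable, hm] using hvert)
    (continuousAt_measureReal_le hV h₀)
  rw [← h, mellinInv]
  simp only [hm, smul_eq_mul, Complex.real_smul]
  push_cast
  rw [one_div]

end

/-! ### Convergence of the Mellin–Barnes integrals -/

lemma norm_Gamma_le_Gamma_re {s : ℂ} (hs : 0 < s.re) :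
    ‖Complex.Gamma s‖ ≤ Real.Gamma s.re := by
  rw [Complex.Gamma_eq_integral hs, Real.Gamma_eq_integral hs, Complex.GammaIntegral]
  refine (norm_integral_le_integral_norm _).trans (le_of_eq ?_)
  refine setIntegral_congr_fun measurableSet_Ioi fun x (hx : 0 < x) => ?_
  simp [Complex.norm_cpow_eq_rpow_re_of_pos hx, Complex.norm_exp]

lemma continuous_Gamma_comp {f : ℝ → ℂ} (hf : Continuous f) (hre : ∀ t, 0 < (f t).re) :
    Continuous fun t => Complex.Gamma (f t) := by
  refine continuous_iff_continuousAt.mpr fun t => ?_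
  refine ContinuousAt.comp (Complex.differentiableAt_Gamma _ fun m hm => ?_).continuousAt
    hf.continuousAt
  have := hre t
  rw [hm] at this
  simp at this
  linarith [m.cast_nonneg (α := ℝ)]

lemma integrable_inv_sq_add_sq {c : ℝ} (hc : 0 < c) :
    Integrable fun t : ℝ => (c ^ 2 + t ^ 2)⁻¹ := by
  have h := (integrable_inv_one_add_sq.comp_mul_left' (inv_ne_zero hc.ne')).const_mul (c ^ 2)⁻¹
  refine h.congr (.of_forall fun t => ?_)
  dsimp only
  rw [← mul_inv]
  congr 1
  field_simp

lemma norm_add_mul_I_le {c d : ℝ} (hc : 0 < c) (hcd : c ≤ d) (t : ℝ) :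
    √(c ^ 2 + t ^ 2) ≤ ‖(d + t * Complex.I : ℂ)‖ := by
  rw [Complex.norm_add_mul_I]
  gcongr

/-- The integrand of `G^{2,3}_{3,3}` with parameters `1, 1 - b, 1 - a` and `a', b', 0` on a vertical
line in the strip separating its poles. -/
lemma meijerIntegrand_eq (a' b' b a : ℂ) (z s : ℂ) (hs : s ≠ 0) (hs' : Complex.Gamma s ≠ 0) :
    meijerIntegrand 2 3 ![1, 1 - b, 1 - a] ![a', b', 0] z s
      = Complex.Gamma (a' - s) * Complex.Gamma (b' - s) * Complex.Gamma (b + s)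
        * Complex.Gamma (a + s) / s * z ^ s := by
  -- The upper parameter 1 contributes `Γ(s)` and the lower parameter 0 contributes `1 / Γ(1 + s)`;
  -- together they give `1 / s`.
  simp [meijerIntegrand, Fin.prod_univ_three, add_comm (1 : ℂ) s, Complex.Gamma_add_one s hs]
  field_simp
  simp

/-- The conditions `-b < c` and `-a < c` follow from `0 < c`, which comes from the parameter 1. -/
lemma meijerSeparates_iff {a' b' b a c : ℝ} (hb : 0 < b) (ha : 0 < a) :
    MeijerSeparates 2 3 ![1, 1 - (b : ℂ), 1 - (a : ℂ)] ![(a' : ℂ), (b' : ℂ), 0] c ↔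
      0 < c ∧ c < a' ∧ c < b' := by
  simp [MeijerSeparates, Fin.forall_fin_succ]
  constructor
  · rintro ⟨⟨h1, h2⟩, h3, -⟩; exact ⟨h3, h1, h2⟩
  · rintro ⟨h3, h1, h2⟩; refine ⟨⟨h1, h2⟩, h3, ?_, ?_⟩ <;> linarith

/-- No Stirling asymptotics are needed. Bounding `|Γ(s)|` by `Γ(Re s)` gives no decay, but `1 / s`
supplies one power of `|s|`, and `Γ(b + s) = Γ(b + s + 1) / (b + s)` another; the resulting bound `C
/ (c ^ 2 + t ^ 2)` is integrable. -/
lemma integrable_Gamma_mul_div {a' b' b a c : ℝ} (hb : 0 < b) (ha : 0 < a) (hc : 0 < c)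
    (ha' : c < a') (hb' : c < b') :
    Integrable fun t : ℝ => Complex.Gamma (a' - (c + t * Complex.I))
      * Complex.Gamma (b' - (c + t * Complex.I)) * Complex.Gamma (b + (c + t * Complex.I))
      * Complex.Gamma (a + (c + t * Complex.I)) / (c + t * Complex.I) := by
  set C := Real.Gamma (a' - c) * Real.Gamma (b' - c) * Real.Gamma (b + c + 1) * Real.Gamma (a + c)
  have hs0 : ∀ t : ℝ, (c + t * Complex.I : ℂ) ≠ 0 := fun t h => by
    have := congrArg Complex.re h; simp at this; linarith
  refine ((integrable_inv_sq_add_sq hc).const_mul C).mono' ?_ (.of_forall fun t => ?_)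
  · refine Continuous.aestronglyMeasurable (Continuous.div (((Continuous.mul ?_ ?_).mul ?_).mul ?_)
      (by fun_prop) hs0) <;>
    exact continuous_Gamma_comp (by fun_prop) fun t => by simp; linarith
  · have h1 : ‖Complex.Gamma (a' - (c + t * Complex.I))‖ ≤ Real.Gamma (a' - c) := by
      refine (norm_Gamma_le_Gamma_re ?_).trans (le_of_eq ?_) <;> simp; linarith
    have h2 : ‖Complex.Gamma (b' - (c + t * Complex.I))‖ ≤ Real.Gamma (b' - c) := by
      refine (norm_Gamma_le_Gamma_re ?_).trans (le_of_eq ?_) <;> simp; linarith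
    have h4 : ‖Complex.Gamma (a + (c + t * Complex.I))‖ ≤ Real.Gamma (a + c) := by
      refine (norm_Gamma_le_Gamma_re ?_).trans (le_of_eq ?_) <;> simp; linarith
    have hne : (b + (c + t * Complex.I) : ℂ) ≠ 0 := fun h => by
      have := congrArg Complex.re h; simp at this; linarith
    have h5 : ‖Complex.Gamma (b + (c + t * Complex.I) + 1)‖ ≤ Real.Gamma (b + c + 1) := by
      refine (norm_Gamma_le_Gamma_re ?_).trans (le_of_eq ?_) <;> simp; linarith
    have hpos : 0 < √(c ^ 2 + t ^ 2) := by positivity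
    have h3 : ‖Complex.Gamma (b + (c + t * Complex.I))‖
        ≤ Real.Gamma (b + c + 1) * (√(c ^ 2 + t ^ 2))⁻¹ := by
      rw [Complex.Gamma_add_one _ hne, norm_mul] at h5
      have h6 : √(c ^ 2 + t ^ 2) ≤ ‖(b + (c + t * Complex.I) : ℂ)‖ := by
        have := norm_add_mul_I_le (d := b + c) hc (by linarith) t
        push_cast at this
        rwa [add_assoc] at this
      rw [← div_eq_mul_inv, le_div_iff₀ hpos, mul_comm]
      exact (mul_le_mul_of_nonneg_right h6 (norm_nonneg _)).trans h5
    have h6 : ‖(c + t * Complex.I : ℂ)‖⁻¹ ≤ (√(c ^ 2 + t ^ 2))⁻¹ :=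
      inv_anti₀ hpos (norm_add_mul_I_le hc le_rfl t)
    rw [norm_div, norm_mul, norm_mul, norm_mul, div_eq_mul_inv]
    have g1 := (norm_nonneg _).trans h1
    have g2 := (norm_nonneg _).trans h2
    have g4 := (norm_nonneg _).trans h4
    have g3 := (norm_nonneg _).trans h3
    calc _ ≤ Real.Gamma (a' - c) * Real.Gamma (b' - c)
          * (Real.Gamma (b + c + 1) * (√(c ^ 2 + t ^ 2))⁻¹) * Real.Gamma (a + c)
          * (√(c ^ 2 + t ^ 2))⁻¹ := by gcongr
      _ = C * (√(c ^ 2 + t ^ 2) ^ 2)⁻¹ := by simp only [C]; ring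
      _ = _ := by rw [Real.sq_sqrt (by positivity)]

lemma integrable_mul_cpow_vertical {f : ℝ → ℂ} (hf : Integrable f) {z : ℝ} (hz : 0 < z) (c : ℝ) :
    Integrable fun t : ℝ => f t * (z : ℂ) ^ (c + t * Complex.I) := by
  have hz' : (z : ℂ) ≠ 0 := by exact_mod_cast hz.ne'
  refine hf.mul_bdd (c := z ^ c) ?_ (.of_forall fun t => ?_)
  · exact Continuous.aestronglyMeasurable
      (Continuous.const_cpow (by fun_prop) (Or.inl hz'))
  · rw [Complex.norm_cpow_eq_rpow_re_of_pos hz]; simp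

lemma meijerGConverges_of_pos {a' b' b a z : ℝ} (ha' : 0 < a') (hb' : 0 < b') (hb : 0 < b)
    (ha : 0 < a) (hz : 0 < z) :
    MeijerGConverges 2 3 ![1, 1 - (b : ℂ), 1 - (a : ℂ)] ![(a' : ℂ), (b' : ℂ), 0] z := by
  refine ⟨⟨min a' b' / 2, (meijerSeparates_iff hb ha).mpr ?_⟩, fun c hc => ?_⟩
  · have := lt_min ha' hb'
    have := min_le_left a' b'
    have := min_le_right a' b'
    refine ⟨?_, ?_, ?_⟩ <;> linarith
  · obtain ⟨hc, h1, h2⟩ := (meijerSeparates_iff hb ha).mp hc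
    refine (integrable_mul_cpow_vertical (integrable_Gamma_mul_div hb ha hc h1 h2) hz c).congr
      (.of_forall fun t => ?_)
    have hre : 0 < (c + t * Complex.I : ℂ).re := by simpa using hc
    exact (meijerIntegrand_eq _ _ _ _ _ _ (fun h => by rw [h] at hre; simp at hre)
      (Complex.Gamma_ne_zero_of_re_pos hre)).symm

/-! ### Signed mixtures of probability densities -/

section
variable {α ι : Type*} [MeasurableSpace α] [Countable ι] {μ : Measure α} {D : ι → α → ℝ}
  {w : ι → ℝ}

lemma hasSum_integral_mixture (hD : ∀ n, Measurable (D n)) (hD₀ : ∀ n y, 0 ≤ D n y) {g : α → ℝ}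
    (hg : ∀ n, Integrable g (μ.withDensity fun y => ENNReal.ofReal (D n y)))
    (hsum : Summable fun n => w n * ∫ y, |g y| ∂μ.withDensity fun y => ENNReal.ofReal (D n y)) :
    HasSum (fun n => w n * ∫ y, g y ∂μ.withDensity fun y => ENNReal.ofReal (D n y))
      (∫ y, (∑' n, w n * D n y) * g y ∂μ) := by
  have hint : ∀ (n : ι) (h : α → ℝ), ∫ y, h y ∂μ.withDensity (fun y => ENNReal.ofReal (D n y))
      = ∫ y, D n y * h y ∂μ := fun n h => by
    rw [integral_withDensity_eq_integral_toReal_smul (hD n).ennreal_ofReal (by simp)]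
    simp [ENNReal.toReal_ofReal (hD₀ n _)]
  have hg' : ∀ n, Integrable (fun y => w n * D n y * g y) μ := fun n => by
    have h := (integrable_withDensity_iff_integrable_smul' (hD n).ennreal_ofReal (by simp)).mp (hg n)
    simpa [ENNReal.toReal_ofReal (hD₀ n _), mul_assoc] using h.const_mul (w n)
  simp only [hint] at hsum ⊢
  convert! hasSum_integral_of_summable_integral_norm hg' ?_ using 1
  · funext n
    simp_rw [mul_assoc, integral_const_mul]
  · simp_rw [tsum_mul_right]
  -- For real series summability is absolute, so signed weights are harmless: the absolute values
  -- are the integrals of the norms.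
  · refine hsum.abs.congr fun n => ?_
    simp_rw [norm_mul, Real.norm_eq_abs, mul_assoc, integral_const_mul, abs_mul]
    congr 1
    rw [abs_of_nonneg (integral_nonneg fun y => mul_nonneg (hD₀ n y) (abs_nonneg _))]
    simp_rw [abs_of_nonneg (hD₀ n _)]

variable [∀ n, IsProbabilityMeasure (μ.withDensity fun y => ENNReal.ofReal (D n y))]

lemma integral_mixture_eq_one (hD : ∀ n, Measurable (D n)) (hD₀ : ∀ n y, 0 ≤ D n y)
    (hw : HasSum w 1) : ∫ y, ∑' n, w n * D n y ∂μ = 1 := by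
  have h := hasSum_integral_mixture (μ := μ) (w := w) hD hD₀ (g := fun _ => 1)
    (fun n => integrable_const _) (by simpa using hw.summable)
  simp only [mul_one] at h
  exact h.unique (by simpa using hw)

/-- If the positive part of a signed mixture of probability densities is a probability density,
then the mixture is nonnegative. -/
lemma ae_nonneg_mixture (hD : ∀ n, Measurable (D n)) (hD₀ : ∀ n y, 0 ≤ D n y) (hw : HasSum w 1)
    (hprob : IsProbabilityMeasure (μ.withDensity fun y => ENNReal.ofReal (∑' n, w n * D n y))) :
    ∀ᵐ y ∂μ, 0 ≤ ∑' n, w n * D n y := by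
  have h1 := integral_mixture_eq_one (μ := μ) hD hD₀ hw
  have hf : Integrable (fun y => ∑' n, w n * D n y) μ := by
    by_contra hn
    rw [integral_undef hn] at h1
    exact zero_ne_one h1
  have h2 : ∫⁻ y, ENNReal.ofReal (∑' n, w n * D n y) ∂μ = 1 := by
    rw [← hprob.measure_univ, withDensity_apply _ MeasurableSet.univ, Measure.restrict_univ]
  rw [integral_eq_lintegral_pos_part_sub_lintegral_neg_part hf, h2] at h1
  -- The identity `h1` now says that the negative part has `toReal` equal to 0; finiteness excludes
  -- the value `⊤`, whose `toReal` is also 0.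
  have h3 : ∫⁻ y, ENNReal.ofReal (-∑' n, w n * D n y) ∂μ ≠ ⊤ :=
    (hf.neg.lintegral_lt_top).ne
  have h4 : ∫⁻ y, ENNReal.ofReal (-∑' n, w n * D n y) ∂μ = 0 := by
    rcases (ENNReal.toReal_eq_zero_iff _).mp (by simpa using h1) with h | h
    · exact h
    · exact absurd h h3
  rw [lintegral_eq_zero_iff'
    (f := fun y => ENNReal.ofReal (-∑' n, w n * D n y)) hf.1.aemeasurable.neg.ennreal_ofReal] at h4
  filter_upwards [h4] with y hy
  simpa using hy

/-- By nonnegativity of the mixture, the truncation by `ENNReal.ofReal` changes nothing almost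
everywhere. -/
lemma hasSum_integral_withDensity_mixture (hD : ∀ n, Measurable (D n)) (hD₀ : ∀ n y, 0 ≤ D n y)
    (hw : HasSum w 1)
    (hprob : IsProbabilityMeasure (μ.withDensity fun y => ENNReal.ofReal (∑' n, w n * D n y)))
    {g : α → ℝ} (hg : ∀ n, Integrable g (μ.withDensity fun y => ENNReal.ofReal (D n y)))
    (hsum : Summable fun n => w n * ∫ y, |g y| ∂μ.withDensity fun y => ENNReal.ofReal (D n y)) :
    HasSum (fun n => w n * ∫ y, g y ∂μ.withDensity fun y => ENNReal.ofReal (D n y))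
      (∫ y, g y ∂μ.withDensity fun y => ENNReal.ofReal (∑' n, w n * D n y)) := by
  have hmeas : Measurable fun y => ∑' n, w n * D n y :=
    Measurable.tsum fun n => (hD n).const_mul _
  rw [integral_withDensity_eq_integral_toReal_smul hmeas.ennreal_ofReal (by simp)]
  convert! hasSum_integral_mixture (μ := μ) hD hD₀ hg hsum using 1
  refine integral_congr_ae ?_
  filter_upwards [ae_nonneg_mixture hD hD₀ hw hprob] with y hy
  simp [ENNReal.toReal_ofReal hy]

end

/-! ### The bivariate Gamma law as a mixture -/

/-- The independent pairs of Gamma variables whose mixture is the bivariate Gamma law. -/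
noncomputable def mixtureComponent (k₁ k₂ θ₁ θ₂ ρ : ℝ) (ij : ℕ × ℕ) : Measure (ℝ × ℝ) :=
  (gammaMeasure (k₁ + ij.1) (1 / (θ₁ * (1 - ρ)))).prod
    (gammaMeasure (k₂ + ij.1 + ij.2) (1 / (θ₂ * (1 - ρ))))

lemma gammaMeasure_prod {a r : ℝ} (a' r' : ℝ) (ha : 0 < a) (hr : 0 < r) :
    (gammaMeasure a r).prod (gammaMeasure a' r') = volume.withDensity fun y : ℝ × ℝ =>
      ENNReal.ofReal (gammaPDFReal a r y.1 * gammaPDFReal a' r' y.2) := by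
  rw [gammaMeasure, gammaMeasure, prod_withDensity (by unfold gammaPDF; fun_prop)
    (by unfold gammaPDF; fun_prop)]
  simp only [gammaPDF, ENNReal.ofReal_mul (gammaPDFReal_nonneg ha hr _)]
  rfl

section
variable {k₁ k₂ θ₁ θ₂ ρ : ℝ}

lemma isProbabilityMeasure_mixtureComponent (hk₁ : 0 < k₁) (hk₂ : 0 < k₂) (hθ₁ : 0 < θ₁)
    (hθ₂ : 0 < θ₂) (hρ₁ : ρ < 1) (ij : ℕ × ℕ) :
    IsProbabilityMeasure (mixtureComponent k₁ k₂ θ₁ θ₂ ρ ij) := by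
  have h : 0 < 1 - ρ := by linarith
  have := isProbabilityMeasure_gammaMeasure (a := k₁ + ij.1) (r := 1 / (θ₁ * (1 - ρ)))
    (by positivity) (by positivity)
  have := isProbabilityMeasure_gammaMeasure (a := k₂ + ij.1 + ij.2) (r := 1 / (θ₂ * (1 - ρ)))
    (by positivity) (by positivity)
  unfold mixtureComponent
  infer_instance

lemma hasSum_integral_bivariateGammaMeasure (hk₁ : 0 < k₁) (hk₂ : 0 < k₂) (hθ₁ : 0 < θ₁)
    (hθ₂ : 0 < θ₂) (hρ₀ : 0 ≤ ρ) (hρ₁ : ρ < 1)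
    (hprob : IsProbabilityMeasure (bivariateGammaMeasure k₁ k₂ θ₁ θ₂ ρ)) {g : ℝ × ℝ → ℝ}
    (hg : ∀ ij, Integrable g (mixtureComponent k₁ k₂ θ₁ θ₂ ρ ij))
    (hsum : Summable fun ij =>
      mixtureWeight k₁ k₂ ρ ij * ∫ y, |g y| ∂mixtureComponent k₁ k₂ θ₁ θ₂ ρ ij) :
    HasSum (fun ij => (1 - ρ) ^ k₂ * mixtureWeight k₁ k₂ ρ ij *
      ∫ y, g y ∂mixtureComponent k₁ k₂ θ₁ θ₂ ρ ij)
      (∫ y, g y ∂bivariateGammaMeasure k₁ k₂ θ₁ θ₂ ρ) := by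
  have h : 0 < 1 - ρ := by linarith
  have hcomp : ∀ ij : ℕ × ℕ, mixtureComponent k₁ k₂ θ₁ θ₂ ρ ij = volume.withDensity
      fun y : ℝ × ℝ => ENNReal.ofReal (gammaPDFReal (k₁ + ij.1) (1 / (θ₁ * (1 - ρ))) y.1 *
        gammaPDFReal (k₂ + ij.1 + ij.2) (1 / (θ₂ * (1 - ρ))) y.2) := fun ij =>
    gammaMeasure_prod _ _ (by positivity) (by positivity)
  have hbiv : bivariateGammaMeasure k₁ k₂ θ₁ θ₂ ρ = volume.withDensity
      fun y : ℝ × ℝ => ENNReal.ofReal (∑' ij : ℕ × ℕ, (1 - ρ) ^ k₂ * mixtureWeight k₁ k₂ ρ ij *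
        (gammaPDFReal (k₁ + ij.1) (1 / (θ₁ * (1 - ρ))) y.1 *
        gammaPDFReal (k₂ + ij.1 + ij.2) (1 / (θ₂ * (1 - ρ))) y.2)) := by
    simp only [bivariateGammaMeasure, bivariateGammaPDFReal, ← tsum_mul_left, mixtureWeight,
      mul_assoc]
  have hprob' := isProbabilityMeasure_mixtureComponent hk₁ hk₂ hθ₁ hθ₂ hρ₁
  simp only [hcomp] at hg hsum hprob' ⊢
  rw [hbiv] at hprob ⊢
  refine hasSum_integral_withDensity_mixture (fun ij => ?_) (fun ij y => ?_) ?_ hprob hg ?_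
  · fun_prop
  · exact mul_nonneg (gammaPDFReal_nonneg (by positivity) (by positivity) _)
      (gammaPDFReal_nonneg (by positivity) (by positivity) _)
  · convert! (hasSum_mixtureWeight (k₁ := k₁) (k₂ := k₂) hρ₀ hρ₁).mul_left ((1 - ρ) ^ k₂) using 1
    rw [← Real.rpow_add h, add_neg_cancel, Real.rpow_zero]
  · simpa only [mul_assoc] using hsum.mul_left ((1 - ρ) ^ k₂)

/-- The weighted mean of the shape `k₁ + i` is `k₁ / (1 - ρ)`, which cancels the factor `1 - ρ` in
the component scale `θ₁ (1 - ρ)`. -/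
lemma integral_fst_bivariateGammaMeasure (hk₁ : 0 < k₁) (hk₂ : 0 < k₂) (hθ₁ : 0 < θ₁)
    (hθ₂ : 0 < θ₂) (hρ₀ : 0 ≤ ρ) (hρ₁ : ρ < 1)
    (hprob : IsProbabilityMeasure (bivariateGammaMeasure k₁ k₂ θ₁ θ₂ ρ)) :
    ∫ y, y.1 ∂bivariateGammaMeasure k₁ k₂ θ₁ θ₂ ρ = k₁ * θ₁ := by
  have h : 0 < 1 - ρ := by linarith
  have hP := fun ij : ℕ × ℕ => isProbabilityMeasure_gammaMeasure (a := k₁ + ij.1)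
    (r := 1 / (θ₁ * (1 - ρ))) (by positivity) (by positivity)
  have hP' := fun ij : ℕ × ℕ => isProbabilityMeasure_gammaMeasure (a := k₂ + ij.1 + ij.2)
    (r := 1 / (θ₂ * (1 - ρ))) (by positivity) (by positivity)
  have hmean : ∀ ij : ℕ × ℕ, ∫ y, y.1 ∂mixtureComponent k₁ k₂ θ₁ θ₂ ρ ij
      = (k₁ + ij.1) * (θ₁ * (1 - ρ)) := fun ij => by
    rw [mixtureComponent, integral_fun_fst (fun x : ℝ => x),
      integral_id_gammaMeasure (by positivity) (by positivity), probReal_univ, one_smul]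
    field_simp
  have habs : ∀ ij : ℕ × ℕ, ∫ y, |y.1| ∂mixtureComponent k₁ k₂ θ₁ θ₂ ρ ij
      = (k₁ + ij.1) * (θ₁ * (1 - ρ)) := fun ij => by
    rw [← hmean]
    refine integral_congr_ae ?_
    filter_upwards [Measure.quasiMeasurePreserving_fst.ae (ae_pos_gammaMeasure _ _)] with y hy
      using abs_of_pos hy
  have hs := hasSum_mixtureWeight_mul_shape_fst (k₁ := k₁) (k₂ := k₂) hρ₀ hρ₁
  have key := hasSum_integral_bivariateGammaMeasure hk₁ hk₂ hθ₁ hθ₂ hρ₀ hρ₁ hprob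
    (g := fun y => y.1)
    (fun ij => (integrable_id_gammaMeasure (by positivity) (by positivity)).comp_fst _)
    (by simpa only [habs, mul_assoc] using hs.summable.mul_right (θ₁ * (1 - ρ)))
  refine key.unique ?_
  convert! hs.mul_left ((1 - ρ) ^ k₂ * (θ₁ * (1 - ρ))) using 1
  · funext ij; rw [hmean]; ring
  · rw [Real.rpow_sub_one h.ne', Real.rpow_neg h.le]
    have := (Real.rpow_pos_of_pos h k₂).ne'
    field_simp

lemma integral_snd_bivariateGammaMeasure (hk₁ : 0 < k₁) (hk₂ : 0 < k₂) (hθ₁ : 0 < θ₁)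
    (hθ₂ : 0 < θ₂) (hρ₀ : 0 ≤ ρ) (hρ₁ : ρ < 1)
    (hprob : IsProbabilityMeasure (bivariateGammaMeasure k₁ k₂ θ₁ θ₂ ρ)) :
    ∫ y, y.2 ∂bivariateGammaMeasure k₁ k₂ θ₁ θ₂ ρ = k₂ * θ₂ := by
  have h : 0 < 1 - ρ := by linarith
  have hP := fun ij : ℕ × ℕ => isProbabilityMeasure_gammaMeasure (a := k₁ + ij.1)
    (r := 1 / (θ₁ * (1 - ρ))) (by positivity) (by positivity)
  have hP' := fun ij : ℕ × ℕ => isProbabilityMeasure_gammaMeasure (a := k₂ + ij.1 + ij.2)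
    (r := 1 / (θ₂ * (1 - ρ))) (by positivity) (by positivity)
  have hmean : ∀ ij : ℕ × ℕ, ∫ y, y.2 ∂mixtureComponent k₁ k₂ θ₁ θ₂ ρ ij
      = (k₂ + ij.1 + ij.2) * (θ₂ * (1 - ρ)) := fun ij => by
    rw [mixtureComponent, integral_fun_snd (fun x : ℝ => x),
      integral_id_gammaMeasure (by positivity) (by positivity), probReal_univ, one_smul]
    field_simp
  have habs : ∀ ij : ℕ × ℕ, ∫ y, |y.2| ∂mixtureComponent k₁ k₂ θ₁ θ₂ ρ ij
      = (k₂ + ij.1 + ij.2) * (θ₂ * (1 - ρ)) := fun ij => by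
    rw [← hmean]
    refine integral_congr_ae ?_
    filter_upwards [Measure.quasiMeasurePreserving_snd.ae (ae_pos_gammaMeasure _ _)] with y hy
      using abs_of_pos hy
  have hs := hasSum_mixtureWeight_mul_shape_snd (k₁ := k₁) (k₂ := k₂) hρ₀ hρ₁
  have key := hasSum_integral_bivariateGammaMeasure hk₁ hk₂ hθ₁ hθ₂ hρ₀ hρ₁ hprob
    (g := fun y => y.2)
    (fun ij => (integrable_id_gammaMeasure (by positivity) (by positivity)).comp_snd _)
    (by simpa only [habs, mul_assoc] using hs.summable.mul_right (θ₂ * (1 - ρ)))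
  refine key.unique ?_
  convert! hs.mul_left ((1 - ρ) ^ k₂ * (θ₂ * (1 - ρ))) using 1
  · funext ij; rw [hmean]; ring
  · rw [Real.rpow_sub_one h.ne', Real.rpow_neg h.le]
    have := (Real.rpow_pos_of_pos h k₂).ne'
    field_simp

/-- Needed for `√b ^ 2 = b`. Every term of the density vanishes when a coordinate is negative. -/
lemma ae_nonneg_bivariateGammaMeasure :
    ∀ᵐ y ∂bivariateGammaMeasure k₁ k₂ θ₁ θ₂ ρ, 0 ≤ y.1 ∧ 0 ≤ y.2 := by
  have hmeas : Measurable fun y : ℝ × ℝ =>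
      ENNReal.ofReal (bivariateGammaPDFReal k₁ k₂ θ₁ θ₂ ρ y.1 y.2) := by
    unfold bivariateGammaPDFReal
    exact ((Measurable.tsum fun ij => by fun_prop).const_mul _).ennreal_ofReal
  rw [bivariateGammaMeasure, ae_withDensity_iff hmeas]
  refine .of_forall fun y hy => ?_
  by_contra hneg
  refine hy ?_
  rcases not_and_or.mp hneg with h | h <;> simp [bivariateGammaPDFReal, gammaPDFReal, h]

end

/-! ### Ratios of products of independent Gamma variables -/

/-- Two independent pairs of independent Gamma variables. -/
noncomputable def gammaQuadruple (a₁ r₁ a₂ r₂ b₁ q₁ b₂ q₂ : ℝ) : Measure ((ℝ × ℝ) × (ℝ × ℝ)) :=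
  ((gammaMeasure a₁ r₁).prod (gammaMeasure a₂ r₂)).prod
    ((gammaMeasure b₁ q₁).prod (gammaMeasure b₂ q₂))

/-- The ratio `y₂ u₂ / (y₁ u₁)` at `((y₁, y₂), (u₁, u₂))`. -/
noncomputable def gainRatio (x : (ℝ × ℝ) × (ℝ × ℝ)) : ℝ := x.1.2 * x.2.2 / (x.1.1 * x.2.1)

lemma measurable_gainRatio : Measurable gainRatio := by
  unfold gainRatio; fun_prop

lemma ofReal_cpow_div_mul {r₁ r₂ q₁ q₂ x : ℝ} (hr₁ : 0 < r₁) (hr₂ : 0 < r₂) (hq₁ : 0 < q₁)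
    (hq₂ : 0 < q₂) (hx : 0 < x) (s : ℂ) :
    ((r₁ * q₁ / (r₂ * q₂ * x) : ℝ) : ℂ) ^ s = (r₁ : ℂ) ^ s * (q₁ : ℂ) ^ s *
      ((r₂ : ℂ) ^ (-s) * (q₂ : ℂ) ^ (-s) * (x : ℂ) ^ (-s)) := by
  have key : ∀ {y : ℝ}, 0 < y → ∀ t : ℂ, (y : ℂ) ^ t = Complex.exp (Real.log y * t) :=
    fun {y} hy t => by
      rw [Complex.cpow_def_of_ne_zero (by exact_mod_cast hy.ne'), Complex.ofReal_log hy.le]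
  rw [key (by positivity), key hr₁, key hq₁, key hr₂, key hq₂, key hx, ← Complex.exp_add,
    ← Complex.exp_add, ← Complex.exp_add, ← Complex.exp_add, Real.log_div (by positivity)
    (by positivity), Real.log_mul (by positivity) (by positivity),
    Real.log_mul (by positivity) (by positivity), Real.log_mul (by positivity) (by positivity)]
  congr 1
  push_cast
  ring

section
variable {a₁ r₁ a₂ r₂ b₁ q₁ b₂ q₂ : ℝ}

lemma isProbabilityMeasure_gammaQuadruple (ha₁ : 0 < a₁) (hr₁ : 0 < r₁) (ha₂ : 0 < a₂)
    (hr₂ : 0 < r₂) (hb₁ : 0 < b₁) (hq₁ : 0 < q₁) (hb₂ : 0 < b₂) (hq₂ : 0 < q₂) :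
    IsProbabilityMeasure (gammaQuadruple a₁ r₁ a₂ r₂ b₁ q₁ b₂ q₂) := by
  have := isProbabilityMeasure_gammaMeasure ha₁ hr₁
  have := isProbabilityMeasure_gammaMeasure ha₂ hr₂
  have := isProbabilityMeasure_gammaMeasure hb₁ hq₁
  have := isProbabilityMeasure_gammaMeasure hb₂ hq₂
  unfold gammaQuadruple
  infer_instance

lemma ae_pos_gammaMeasure_prod {a r a' r' : ℝ} (ha : 0 < a) (hr : 0 < r) (ha' : 0 < a')
    (hr' : 0 < r') :
    ∀ᵐ y ∂(gammaMeasure a r).prod (gammaMeasure a' r'), 0 < y.1 ∧ 0 < y.2 := by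
  have := isProbabilityMeasure_gammaMeasure ha hr
  have := isProbabilityMeasure_gammaMeasure ha' hr'
  filter_upwards [Measure.quasiMeasurePreserving_fst.ae (ae_pos_gammaMeasure a r),
    Measure.quasiMeasurePreserving_snd.ae (ae_pos_gammaMeasure a' r')] with y h₁ h₂
  exact ⟨h₁, h₂⟩

lemma ae_pos_gammaQuadruple (ha₁ : 0 < a₁) (hr₁ : 0 < r₁) (ha₂ : 0 < a₂)
    (hr₂ : 0 < r₂) (hb₁ : 0 < b₁) (hq₁ : 0 < q₁) (hb₂ : 0 < b₂) (hq₂ : 0 < q₂) :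
    ∀ᵐ x ∂gammaQuadruple a₁ r₁ a₂ r₂ b₁ q₁ b₂ q₂,
      (0 < x.1.1 ∧ 0 < x.1.2) ∧ 0 < x.2.1 ∧ 0 < x.2.2 := by
  have := isProbabilityMeasure_gammaMeasure ha₁ hr₁
  have := isProbabilityMeasure_gammaMeasure ha₂ hr₂
  have := isProbabilityMeasure_gammaMeasure hb₁ hq₁
  have := isProbabilityMeasure_gammaMeasure hb₂ hq₂
  unfold gammaQuadruple
  filter_upwards [Measure.quasiMeasurePreserving_fst.ae
      (ae_pos_gammaMeasure_prod ha₁ hr₁ ha₂ hr₂),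
    Measure.quasiMeasurePreserving_snd.ae
      (ae_pos_gammaMeasure_prod hb₁ hq₁ hb₂ hq₂)] with x h₁ h₂
  exact ⟨h₁, h₂⟩

lemma integral_gainRatio_cpow (ha₁ : 0 < a₁) (hr₁ : 0 < r₁) (ha₂ : 0 < a₂)
    (hr₂ : 0 < r₂) (hb₁ : 0 < b₁) (hq₁ : 0 < q₁) (hb₂ : 0 < b₂) (hq₂ : 0 < q₂) {s : ℂ}
    (hs : 0 < s.re) (hsa : s.re < a₁) (hsb : s.re < b₁) :
    ∫ x, (gainRatio x : ℂ) ^ s ∂gammaQuadruple a₁ r₁ a₂ r₂ b₁ q₁ b₂ q₂ =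
      (Complex.Gamma (a₁ - s) / Real.Gamma a₁ * (r₁ : ℂ) ^ s) *
      (Complex.Gamma (a₂ + s) / Real.Gamma a₂ * (r₂ : ℂ) ^ (-s)) *
      ((Complex.Gamma (b₁ - s) / Real.Gamma b₁ * (q₁ : ℂ) ^ s) *
      (Complex.Gamma (b₂ + s) / Real.Gamma b₂ * (q₂ : ℂ) ^ (-s))) := by
  have := isProbabilityMeasure_gammaMeasure ha₁ hr₁
  have := isProbabilityMeasure_gammaMeasure ha₂ hr₂
  have := isProbabilityMeasure_gammaMeasure hb₁ hq₁
  have := isProbabilityMeasure_gammaMeasure hb₂ hq₂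
  have h : ∫ x, (gainRatio x : ℂ) ^ s ∂gammaQuadruple a₁ r₁ a₂ r₂ b₁ q₁ b₂ q₂ =
      ∫ x : (ℝ × ℝ) × (ℝ × ℝ), ((x.1.1 : ℂ) ^ (-s) * (x.1.2 : ℂ) ^ s) *
        ((x.2.1 : ℂ) ^ (-s) * (x.2.2 : ℂ) ^ s) ∂gammaQuadruple a₁ r₁ a₂ r₂ b₁ q₁ b₂ q₂ := by
    refine integral_congr_ae ?_
    filter_upwards [ae_pos_gammaQuadruple ha₁ hr₁ ha₂ hr₂ hb₁ hq₁ hb₂ hq₂]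
      with x ⟨⟨h1, h2⟩, h3, h4⟩
    have := ofReal_cpow_div_mul h2 h1 h4 h3 one_pos s
    simp only [mul_one, Complex.ofReal_one, Complex.one_cpow] at this
    rw [gainRatio, this]
    ring
  rw [h, gammaQuadruple,
    integral_prod_mul (fun y : ℝ × ℝ => (y.1 : ℂ) ^ (-s) * (y.2 : ℂ) ^ s)
      (fun y : ℝ × ℝ => (y.1 : ℂ) ^ (-s) * (y.2 : ℂ) ^ s),
    integral_prod_mul (fun y : ℝ => (y : ℂ) ^ (-s)) (fun y : ℝ => (y : ℂ) ^ s),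
    integral_prod_mul (fun y : ℝ => (y : ℂ) ^ (-s)) (fun y : ℝ => (y : ℂ) ^ s),
    integral_cpow_gammaMeasure ha₁ hr₁ (by simpa using hsa),
    integral_cpow_gammaMeasure hb₁ hq₁ (by simpa using hsb),
    integral_cpow_gammaMeasure ha₂ hr₂ (by linarith),
    integral_cpow_gammaMeasure hb₂ hq₂ (by linarith)]
  simp only [neg_neg, ← sub_eq_add_neg]

lemma integrable_gainRatio_rpow (ha₁ : 0 < a₁) (hr₁ : 0 < r₁) (ha₂ : 0 < a₂)
    (hr₂ : 0 < r₂) (hb₁ : 0 < b₁) (hq₁ : 0 < q₁) (hb₂ : 0 < b₂) (hq₂ : 0 < q₂) {c : ℝ}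
    (hc : 0 < c) (hca : c < a₁) (hcb : c < b₁) :
    Integrable (fun x => gainRatio x ^ c) (gammaQuadruple a₁ r₁ a₂ r₂ b₁ q₁ b₂ q₂) := by
  have := isProbabilityMeasure_gammaMeasure ha₁ hr₁
  have := isProbabilityMeasure_gammaMeasure ha₂ hr₂
  have := isProbabilityMeasure_gammaMeasure hb₁ hq₁
  have := isProbabilityMeasure_gammaMeasure hb₂ hq₂
  have h := Integrable.mul_prod
    ((integrable_rpow_gammaMeasure (c := -c) ha₁ hr₁ (by linarith)).mul_prod
      (integrable_rpow_gammaMeasure (c := c) ha₂ hr₂ (by linarith)))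
    ((integrable_rpow_gammaMeasure (c := -c) hb₁ hq₁ (by linarith)).mul_prod
      (integrable_rpow_gammaMeasure (c := c) hb₂ hq₂ (by linarith)))
  refine h.congr ?_
  filter_upwards [ae_pos_gammaQuadruple ha₁ hr₁ ha₂ hr₂ hb₁ hq₁ hb₂ hq₂]
    with x ⟨⟨h1, h2⟩, h3, h4⟩
  rw [gainRatio, Real.div_rpow (by positivity) (by positivity), Real.mul_rpow h2.le h4.le,
    Real.mul_rpow h1.le h3.le, Real.rpow_neg h1.le, Real.rpow_neg h3.le, div_eq_mul_inv, mul_inv]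
  ring

/-- With three of the variables fixed, at most one value of the fourth gives the ratio `v`, and
Gamma laws have no atoms. Positivity of `v` excludes the degenerate cases in which the ratio is 0,
division by zero included. -/
lemma gammaQuadruple_gainRatio_eq (ha₁ : 0 < a₁) (hr₁ : 0 < r₁) (ha₂ : 0 < a₂)
    (hr₂ : 0 < r₂) (hb₁ : 0 < b₁) (hq₁ : 0 < q₁) (hb₂ : 0 < b₂) (hq₂ : 0 < q₂) {v : ℝ}
    (hv : 0 < v) : gammaQuadruple a₁ r₁ a₂ r₂ b₁ q₁ b₂ q₂ {x | gainRatio x = v} = 0 := by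
  have := isProbabilityMeasure_gammaMeasure ha₁ hr₁
  have := isProbabilityMeasure_gammaMeasure ha₂ hr₂
  have := isProbabilityMeasure_gammaMeasure hb₁ hq₁
  have := isProbabilityMeasure_gammaMeasure hb₂ hq₂
  have hm : MeasurableSet {x | gainRatio x = v} := measurable_gainRatio (measurableSet_singleton v)
  refine Measure.measure_prod_null_of_ae_null hm (.of_forall fun y => ?_)
  refine Measure.measure_prod_null_of_ae_null (measurable_prodMk_left hm)
    (.of_forall fun u => Set.Subsingleton.measure_zero (fun s hs t ht => ?_) _)
  simp only [Set.mem_preimage, Set.mem_ofPred_eq, gainRatio] at hs ht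
  have hne : y.1 * u ≠ 0 := fun h => by rw [h, div_zero] at hs; exact hv.ne hs
  have hs' := hs.trans ht.symm
  rw [div_left_inj' hne] at hs'
  refine mul_left_cancel₀ (fun h => ?_) hs'
  rw [h, zero_mul, zero_div] at hs
  exact hv.ne hs

/-- The tail of a ratio of products of independent Gamma variables is a Meijer G-function. -/
lemma measureReal_le_gainRatio (ha₁ : 0 < a₁) (hr₁ : 0 < r₁) (ha₂ : 0 < a₂)
    (hr₂ : 0 < r₂) (hb₁ : 0 < b₁) (hq₁ : 0 < q₁) (hb₂ : 0 < b₂) (hq₂ : 0 < q₂) {v : ℝ}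
    (hv : 0 < v) :
    ((gammaQuadruple a₁ r₁ a₂ r₂ b₁ q₁ b₂ q₂).real {x | v ≤ gainRatio x} : ℂ) =
      (Real.Gamma a₁ * Real.Gamma a₂ * Real.Gamma b₁ * Real.Gamma b₂ : ℂ)⁻¹ *
        meijerG 2 3 ![1, 1 - (b₂ : ℂ), 1 - (a₂ : ℂ)] ![(a₁ : ℂ), (b₁ : ℂ), 0]
          ((r₁ * q₁ / (r₂ * q₂ * v) : ℝ) : ℂ) := by
  have hQ := isProbabilityMeasure_gammaQuadruple ha₁ hr₁ ha₂ hr₂ hb₁ hq₁ hb₂ hq₂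
  have hz : 0 < r₁ * q₁ / (r₂ * q₂ * v) := by positivity
  have hsep := (meijerGConverges_of_pos ha₁ hb₁ hb₂ ha₂ hz).1
  rw [meijerG, dif_pos hsep]
  obtain ⟨hc, hca, hcb⟩ := (meijerSeparates_iff hb₂ ha₂).mp hsep.choose_spec
  -- Mellin inversion holds on every separating line, so the particular line chosen in `meijerG` is
  -- irrelevant.
  generalize hsep.choose = c at hc hca hcb
  have hre : ∀ t : ℝ, (c + t * Complex.I : ℂ).re = c := fun t => by simp
  have hmom := fun t : ℝ => integral_gainRatio_cpow ha₁ hr₁ ha₂ hr₂ hb₁ hq₁ hb₂ hq₂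
    (s := c + t * Complex.I) (by rwa [hre]) (by rwa [hre]) (by rwa [hre])
  have hs0 : ∀ t : ℝ, (c + t * Complex.I : ℂ) ≠ 0 := fun t h => by
    have := hre t; rw [h] at this; simp at this; exact hc.ne this
  have hkey : ∀ t : ℝ, (v : ℂ) ^ (-(c + t * Complex.I)) *
      ((∫ x, (gainRatio x : ℂ) ^ (c + t * Complex.I) ∂gammaQuadruple a₁ r₁ a₂ r₂ b₁ q₁ b₂ q₂) /
        (c + t * Complex.I)) =
      (Real.Gamma a₁ * Real.Gamma a₂ * Real.Gamma b₁ * Real.Gamma b₂ : ℂ)⁻¹ *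
        meijerIntegrand 2 3 ![1, 1 - (b₂ : ℂ), 1 - (a₂ : ℂ)] ![(a₁ : ℂ), (b₁ : ℂ), 0]
          ((r₁ * q₁ / (r₂ * q₂ * v) : ℝ) : ℂ) (c + t * Complex.I) := fun t => by
    rw [hmom, meijerIntegrand_eq _ _ _ _ _ _ (hs0 t)
      (Complex.Gamma_ne_zero_of_re_pos (by rwa [hre])), ofReal_cpow_div_mul hr₁ hr₂ hq₁ hq₂ hv]
    simp only [div_eq_mul_inv, mul_inv]
    ring
  have hvert : Integrable fun t : ℝ =>
      (∫ x, (gainRatio x : ℂ) ^ (c + t * Complex.I) ∂gammaQuadruple a₁ r₁ a₂ r₂ b₁ q₁ b₂ q₂) /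
        (c + t * Complex.I) := by
    -- Inversion requires integrability without the factor `v ^ (-s)`, hence 1 in place of `v`.
    have h1 := (integrable_mul_cpow_vertical
      (integrable_Gamma_mul_div (a' := a₁) (b' := b₁) hb₂ ha₂ hc hca hcb)
      (z := r₁ * q₁ / (r₂ * q₂ * 1)) (by positivity) c).const_mul
      (Real.Gamma a₁ * Real.Gamma a₂ * Real.Gamma b₁ * Real.Gamma b₂ : ℂ)⁻¹
    refine h1.congr (.of_forall fun t => ?_)
    dsimp only
    rw [hmom, ofReal_cpow_div_mul hr₁ hr₂ hq₁ hq₂ one_pos]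
    simp only [div_eq_mul_inv, mul_inv, Complex.ofReal_one, Complex.one_cpow]
    ring
  rw [measureReal_le_eq_integral_cpow measurable_gainRatio ?_ hc
    (integrable_gainRatio_rpow ha₁ hr₁ ha₂ hr₂ hb₁ hq₁ hb₂ hq₂ hc hca hcb) hv
    (gammaQuadruple_gainRatio_eq ha₁ hr₁ ha₂ hr₂ hb₁ hq₁ hb₂ hq₂ hv) hvert]
  · simp only [hkey, integral_const_mul]
    ring
  · filter_upwards [ae_pos_gammaQuadruple ha₁ hr₁ ha₂ hr₂ hb₁ hq₁ hb₂ hq₂]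
      with x ⟨⟨h1, h2⟩, h3, h4⟩
    unfold gainRatio
    positivity

end

/-! ### The secrecy outage probability -/

lemma measureReal_prod_eq_integral {α β : Type*} [MeasurableSpace α] [MeasurableSpace β]
    (μ : Measure α) (ν : Measure β) [SFinite μ] [IsFiniteMeasure ν] {E : Set (α × β)}
    (hE : MeasurableSet E) :
    (μ.prod ν).real E = ∫ y, ν.real (Prod.mk y ⁻¹' E) ∂μ := by
  simp only [measureReal_def]
  rw [Measure.prod_apply hE, integral_toReal (measurable_measure_prodMk_left hE).aemeasurable
    (.of_forall fun y => measure_lt_top _ _)]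

/-- The mixture formula is applied to the section probability `ν.real (Prod.mk y ⁻¹' E)`. It lies in
`[0, 1]`, so summability of the weights suffices. -/
lemma hasSum_measureReal_bivariateGammaMeasure_prod {k₁ k₂ θ₁ θ₂ ρ : ℝ} (hk₁ : 0 < k₁)
    (hk₂ : 0 < k₂) (hθ₁ : 0 < θ₁) (hθ₂ : 0 < θ₂) (hρ₀ : 0 ≤ ρ) (hρ₁ : ρ < 1)
    (hprob : IsProbabilityMeasure (bivariateGammaMeasure k₁ k₂ θ₁ θ₂ ρ))
    {β : Type*} [MeasurableSpace β] (ν : Measure β) [IsProbabilityMeasure ν]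
    {E : Set ((ℝ × ℝ) × β)} (hE : MeasurableSet E) :
    HasSum (fun ij => (1 - ρ) ^ k₂ * mixtureWeight k₁ k₂ ρ ij *
      ((mixtureComponent k₁ k₂ θ₁ θ₂ ρ ij).prod ν).real E)
      (((bivariateGammaMeasure k₁ k₂ θ₁ θ₂ ρ).prod ν).real E) := by
  have hcomp := isProbabilityMeasure_mixtureComponent hk₁ hk₂ hθ₁ hθ₂ hρ₁
  simp only [measureReal_prod_eq_integral _ ν hE]
  have hmeas : Measurable fun y => ν.real (Prod.mk y ⁻¹' E) :=
    (measurable_measure_prodMk_left hE).ennreal_toReal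
  have hint : ∀ ij, Integrable (fun y => ν.real (Prod.mk y ⁻¹' E))
      (mixtureComponent k₁ k₂ θ₁ θ₂ ρ ij) := fun ij =>
    Integrable.of_bound hmeas.aestronglyMeasurable 1 (.of_forall fun y => by
      rw [Real.norm_of_nonneg measureReal_nonneg]; exact measureReal_le_one)
  refine hasSum_integral_bivariateGammaMeasure hk₁ hk₂ hθ₁ hθ₂ hρ₀ hρ₁ hprob hint ?_
  refine Summable.of_norm_bounded
    (hasSum_mixtureWeight (k₁ := k₁) (k₂ := k₂) hρ₀ hρ₁).summable.norm fun ij => ?_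
  rw [norm_mul]
  refine mul_le_of_le_one_right (norm_nonneg _) ?_
  simp_rw [abs_of_nonneg (measureReal_nonneg (μ := ν))]
  rw [← measureReal_prod_eq_integral _ ν hE, Real.norm_of_nonneg measureReal_nonneg]
  exact measureReal_le_one

lemma Gamma_add_nat_eq_pochhammerSymbol_mul {x : ℝ} (hx : 0 < x) (n : ℕ) :
    Real.Gamma (x + n) = pochhammerSymbol x n * Real.Gamma x := by
  induction n with
  | zero => simp [pochhammerSymbol]
  | succ n ih =>
    rw [Nat.cast_succ, ← add_assoc, Real.Gamma_add_one (by positivity), ih, pochhammerSymbol_succ]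
    ring

lemma secrecyOutage_zero {S : Type*} [MeasurableSpace S] (P : Measure S) [IsProbabilityMeasure P]
    {γ₁ γ₂ : S → ℝ} (h₁ : AEMeasurable γ₁ P) (h₂ : AEMeasurable γ₂ P) :
    secrecyOutage P γ₁ γ₂ 0 = P.real {ω | γ₁ ω ≤ γ₂ ω} := by
  have hset : {ω | γ₁ ω ≤ γ₂ ω} = {ω | γ₂ ω < γ₁ ω}ᶜ := by
    ext ω; simp
  rw [hset, probReal_compl_eq_one_sub₀ (nullMeasurableSet_lt h₂ h₁), secrecyOutage]
  simp

/-- The event that the SNR at the legitimate receiver is at most the one at the eavesdropper,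
as an event on the shadowing and the squared fading amplitudes. -/
def outageEvent (p σB σE : ℝ) : Set ((ℝ × ℝ) × (ℝ × ℝ)) :=
  {x | p * (x.1.1 * x.2.1) / σB ^ 2 ≤ p * (x.1.2 * x.2.2) / σE ^ 2}

lemma measurableSet_outageEvent (p σB σE : ℝ) : MeasurableSet (outageEvent p σB σE) :=
  measurableSet_le (by fun_prop) (by fun_prop)

lemma measureReal_outageEvent {a₁ r₁ a₂ r₂ b₁ q₁ b₂ q₂ p σB σE : ℝ} (ha₁ : 0 < a₁) (hr₁ : 0 < r₁)
    (ha₂ : 0 < a₂) (hr₂ : 0 < r₂) (hb₁ : 0 < b₁) (hq₁ : 0 < q₁) (hb₂ : 0 < b₂) (hq₂ : 0 < q₂)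
    (hp : 0 < p) (hσB : 0 < σB) (hσE : 0 < σE) :
    (gammaQuadruple a₁ r₁ a₂ r₂ b₁ q₁ b₂ q₂).real (outageEvent p σB σE) =
      (gammaQuadruple a₁ r₁ a₂ r₂ b₁ q₁ b₂ q₂).real {x | σE ^ 2 / σB ^ 2 ≤ gainRatio x} := by
  refine measureReal_congr ?_
  filter_upwards [ae_pos_gammaQuadruple ha₁ hr₁ ha₂ hr₂ hb₁ hq₁ hb₂ hq₂]
    with x ⟨⟨h1, h2⟩, h3, h4⟩
  refine propext ?_
  change p * (x.1.1 * x.2.1) / σB ^ 2 ≤ p * (x.1.2 * x.2.2) / σE ^ 2 ↔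
    σE ^ 2 / σB ^ 2 ≤ x.1.2 * x.2.2 / (x.1.1 * x.2.1)
  rw [div_le_div_iff₀ (by positivity) (by positivity), div_le_div_iff₀ (by positivity)
    (by positivity), mul_assoc p, mul_assoc p, mul_le_mul_iff_right₀ hp, mul_comm (σE ^ 2)]

theorem proposition2 {S : Type*} [MeasurableSpace S] (P : Measure S) [IsProbabilityMeasure P]
    -- parameters: fading shapes, shadowing shapes and scales, average fading powers,
    -- shadowing correlation, transmit power, noise standard deviations
    (m₁ m₂ k₁ k₂ θ₁ θ₂ Ω₁ Ω₂ ρ p σB σE : ℝ)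
    (hm₁ : 0 < m₁) (hm₂ : 0 < m₂) (hk₁ : 0 < k₁) (hk₂ : 0 < k₂) (hθ₁ : 0 < θ₁) (hθ₂ : 0 < θ₂)
    (hΩ₁ : 0 < Ω₁) (hΩ₂ : 0 < Ω₂) (hρ₀ : 0 ≤ ρ) (hρ₁ : ρ < 1)
    (hp : 0 < p) (hσB : 0 < σB) (hσE : 0 < σE)
    -- correlated shadowing `b₁`, `b₂` and independent small-scale fading `w₁`, `w₂`
    (b₁ b₂ w₁ w₂ : S → ℝ)
    (hb : HasLaw (fun ω => (b₁ ω, b₂ ω)) (bivariateGammaMeasure k₁ k₂ θ₁ θ₂ ρ) P)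
    (hw₁ : HasLaw w₁ (nakagamiMeasure m₁ Ω₁) P) (hw₂ : HasLaw w₂ (nakagamiMeasure m₂ Ω₂) P)
    (hw : IndepFun w₁ w₂ P)
    (hbw : IndepFun (fun ω => (b₁ ω, b₂ ω)) (fun ω => (w₁ ω, w₂ ω)) P)
    -- amplitudes, instantaneous SNRs and average SNRs
    (gB gE γ₁ γ₂ : S → ℝ) (γbar₁ γbar₂ : ℝ)
    (hgB : gB = channelAmplitude b₁ w₁) (hgE : gE = channelAmplitude b₂ w₂)
    (hγ₁ : γ₁ = snr p σB gB) (hγ₂ : γ₂ = snr p σE gE)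
    (hγbar₁ : γbar₁ = averageSNR P p σB gB) (hγbar₂ : γbar₂ = averageSNR P p σE gE)
    -- the Meijer functions and the terms of the series
    (G T : ℕ × ℕ → ℂ)
    (hG : ∀ i j : ℕ, G (i, j) =
      meijerG 2 3 ![1, 1 - (m₂ : ℂ), 1 - i - j - k₂] ![i + (k₁ : ℂ), (m₁ : ℂ), 0]
        ((m₁ * k₁ * γbar₂ / (m₂ * k₂ * γbar₁) : ℝ) : ℂ))
    (hT : ∀ i j : ℕ, T (i, j) =
      ((pochhammerSymbol k₁ i * pochhammerSymbol (k₂ - k₁) j * ρ ^ (i + j)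
        / (i.factorial * j.factorial * pochhammerSymbol (i + k₂) j
          * Real.Gamma (i + k₁) * Real.Gamma (i + k₂)) : ℝ) : ℂ) * G (i, j)) :
    secrecyOutage P γ₁ γ₂ 0 = P.real {ω | γ₁ ω ≤ γ₂ ω} ∧
    (∀ i j : ℕ, MeijerGConverges 2 3
      ![1, 1 - (m₂ : ℂ), 1 - i - j - k₂] ![i + (k₁ : ℂ), (m₁ : ℂ), 0]
      ((m₁ * k₁ * γbar₂ / (m₂ * k₂ * γbar₁) : ℝ) : ℂ)) ∧
    Summable T ∧
    (secrecyOutage P γ₁ γ₂ 0 : ℂ) =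
      (((1 - ρ) ^ k₂ / (Real.Gamma m₁ * Real.Gamma m₂) : ℝ) : ℂ) * ∑' ij : ℕ × ℕ, T ij := by
  have h1ρ : 0 < 1 - ρ := by linarith
  -- The admissibility of the parameters is implicit in `hb`: the law of a random pair has mass 1.
  have hbiv : IsProbabilityMeasure (bivariateGammaMeasure k₁ k₂ θ₁ θ₂ ρ) :=
    hb.isProbabilityMeasure_iff.mp inferInstance
  have hgam₁ := isProbabilityMeasure_gammaMeasure hm₁ (div_pos hm₁ hΩ₁)
  have hgam₂ := isProbabilityMeasure_gammaMeasure hm₂ (div_pos hm₂ hΩ₂)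
  have hsq : Measurable fun x : ℝ => x ^ 2 := by fun_prop
  have hu₁ : HasLaw (fun ω => w₁ ω ^ 2) (gammaMeasure m₁ (m₁ / Ω₁)) P :=
    HasLaw.fun_comp ⟨hsq.aemeasurable, map_sq_nakagamiMeasure hm₁ hΩ₁⟩ hw₁
  have hu₂ : HasLaw (fun ω => w₂ ω ^ 2) (gammaMeasure m₂ (m₂ / Ω₂)) P :=
    HasLaw.fun_comp ⟨hsq.aemeasurable, map_sq_nakagamiMeasure hm₂ hΩ₂⟩ hw₂
  have hu := (indepFun_iff_hasLaw_prodMk_prod hu₁ hu₂).mp (hw.comp hsq hsq)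
  have hbu : IndepFun (fun ω => (b₁ ω, b₂ ω)) (fun ω => (w₁ ω ^ 2, w₂ ω ^ 2)) P :=
    hbw.comp measurable_id (hsq.prodMap hsq)
  have hJ := (indepFun_iff_hasLaw_prodMk_prod hb hu).mp hbu
  have hnonneg : ∀ᵐ ω ∂P, 0 ≤ b₁ ω ∧ 0 ≤ b₂ ω := by
    refine (hb.ae_iff (p := fun y : ℝ × ℝ => 0 ≤ y.1 ∧ 0 ≤ y.2) ?_).mpr
      ae_nonneg_bivariateGammaMeasure
    exact measurableSet_setOfPred.mp ((measurableSet_le measurable_const measurable_fst).inter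
      (measurableSet_le measurable_const measurable_snd))
  have hgB2 : ∀ᵐ ω ∂P, gB ω ^ 2 = b₁ ω * w₁ ω ^ 2 := by
    filter_upwards [hnonneg] with ω hω
    rw [hgB, channelAmplitude, mul_pow, Real.sq_sqrt hω.1]
  have hgE2 : ∀ᵐ ω ∂P, gE ω ^ 2 = b₂ ω * w₂ ω ^ 2 := by
    filter_upwards [hnonneg] with ω hω
    rw [hgE, channelAmplitude, mul_pow, Real.sq_sqrt hω.2]
  have hγbar₁' : γbar₁ = p * (k₁ * θ₁ * Ω₁) / σB ^ 2 := by
    have hI := hJ.integral_comp (f := fun x => x.1.1 * x.2.1) (by fun_prop)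
    simp only [Function.comp_def] at hI
    rw [hγbar₁, averageSNR, integral_congr_ae hgB2, hI,
      integral_prod_mul (fun y : ℝ × ℝ => y.1) (fun u : ℝ × ℝ => u.1),
      integral_fst_bivariateGammaMeasure hk₁ hk₂ hθ₁ hθ₂ hρ₀ hρ₁ hbiv,
      integral_fun_fst (fun x : ℝ => x), integral_id_gammaMeasure hm₁ (div_pos hm₁ hΩ₁),
      probReal_univ, one_smul, div_div_cancel₀ hm₁.ne']
  have hγbar₂' : γbar₂ = p * (k₂ * θ₂ * Ω₂) / σE ^ 2 := by
    have hI := hJ.integral_comp (f := fun x => x.1.2 * x.2.2) (by fun_prop)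
    simp only [Function.comp_def] at hI
    rw [hγbar₂, averageSNR, integral_congr_ae hgE2, hI,
      integral_prod_mul (fun y : ℝ × ℝ => y.2) (fun u : ℝ × ℝ => u.2),
      integral_snd_bivariateGammaMeasure hk₁ hk₂ hθ₁ hθ₂ hρ₀ hρ₁ hbiv,
      integral_fun_snd (fun x : ℝ => x), integral_id_gammaMeasure hm₂ (div_pos hm₂ hΩ₂),
      probReal_univ, one_smul, div_div_cancel₀ hm₂.ne']
  -- The right side is the argument `r₁ q₁ / (r₂ q₂ v)` of `measureReal_le_gainRatio`; it is the
  -- same for all components, which differ only in their shapes.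
  have hz : m₁ * k₁ * γbar₂ / (m₂ * k₂ * γbar₁) =
      1 / (θ₁ * (1 - ρ)) * (m₁ / Ω₁) / (1 / (θ₂ * (1 - ρ)) * (m₂ / Ω₂) * (σE ^ 2 / σB ^ 2)) := by
    rw [hγbar₁', hγbar₂']
    field_simp
  have hzpos : 0 < m₁ * k₁ * γbar₂ / (m₂ * k₂ * γbar₁) := by
    rw [hz]; positivity
  have hA : ∀ i j : ℕ, (![1, 1 - (m₂ : ℂ), 1 - i - j - k₂] : Fin 3 → ℂ) =
      ![1, 1 - (m₂ : ℂ), 1 - ((k₂ + i + j : ℝ) : ℂ)] := fun i j => by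
    congr 3; push_cast; ring_nf
  have hB : ∀ i : ℕ, (![i + (k₁ : ℂ), (m₁ : ℂ), 0] : Fin 3 → ℂ) =
      ![((k₁ + i : ℝ) : ℂ), (m₁ : ℂ), 0] := fun i => by
    congr 1; push_cast; ring
  have hmeasB : AEMeasurable γ₁ P := by
    have hb₁ : AEMeasurable b₁ P := hb.aemeasurable.fst
    have := hw₁.aemeasurable
    rw [hγ₁, hgB]; unfold snr channelAmplitude; fun_prop
  have hmeasE : AEMeasurable γ₂ P := by
    have hb₂ : AEMeasurable b₂ P := hb.aemeasurable.snd
    have := hw₂.aemeasurable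
    rw [hγ₂, hgE]; unfold snr channelAmplitude; fun_prop
  have hout := secrecyOutage_zero P hmeasB hmeasE
  have hevent : P.real {ω | γ₁ ω ≤ γ₂ ω} =
      ((bivariateGammaMeasure k₁ k₂ θ₁ θ₂ ρ).prod
        ((gammaMeasure m₁ (m₁ / Ω₁)).prod (gammaMeasure m₂ (m₂ / Ω₂)))).real
          (outageEvent p σB σE) := by
    refine Eq.trans (measureReal_congr ?_) (hJ.measureReal_eq (p := (· ∈ outageEvent p σB σE))
      (measurableSet_outageEvent p σB σE))
    filter_upwards [hgB2, hgE2] with ω h₁ h₂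
    refine propext ?_
    change γ₁ ω ≤ γ₂ ω ↔ p * (b₁ ω * w₁ ω ^ 2) / σB ^ 2 ≤ p * (b₂ ω * w₂ ω ^ 2) / σE ^ 2
    rw [hγ₁, hγ₂, snr, snr, h₁, h₂]
  have hterm : ∀ ij : ℕ × ℕ, (((1 - ρ) ^ k₂ * mixtureWeight k₁ k₂ ρ ij *
      ((mixtureComponent k₁ k₂ θ₁ θ₂ ρ ij).prod
        ((gammaMeasure m₁ (m₁ / Ω₁)).prod (gammaMeasure m₂ (m₂ / Ω₂)))).real
          (outageEvent p σB σE) : ℝ) : ℂ) =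
      (((1 - ρ) ^ k₂ / (Real.Gamma m₁ * Real.Gamma m₂) : ℝ) : ℂ) * T ij := by
    rintro ⟨i, j⟩
    have h := measureReal_le_gainRatio (a₁ := k₁ + i) (r₁ := 1 / (θ₁ * (1 - ρ)))
      (a₂ := k₂ + i + j) (r₂ := 1 / (θ₂ * (1 - ρ))) (by positivity) (by positivity)
      (by positivity) (by positivity) hm₁ (div_pos hm₁ hΩ₁) hm₂ (div_pos hm₂ hΩ₂)
      (v := σE ^ 2 / σB ^ 2) (by positivity)
    rw [← hz, ← hA, ← hB, ← hG, ← measureReal_outageEvent (by positivity) (by positivity)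
      (by positivity) (by positivity) hm₁ (div_pos hm₁ hΩ₁) hm₂ (div_pos hm₂ hΩ₂) hp hσB hσE] at h
    have hquad : (mixtureComponent k₁ k₂ θ₁ θ₂ ρ (i, j)).prod
        ((gammaMeasure m₁ (m₁ / Ω₁)).prod (gammaMeasure m₂ (m₂ / Ω₂))) =
        gammaQuadruple (k₁ + i) (1 / (θ₁ * (1 - ρ))) (k₂ + i + j) (1 / (θ₂ * (1 - ρ)))
          m₁ (m₁ / Ω₁) m₂ (m₂ / Ω₂) := rfl
    -- The factor `(i + k₂)_j` in the series comes from `Γ(k₂ + i + j) = (k₂ + i)_j Γ(k₂ + i)`.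
    rw [hquad, Complex.ofReal_mul, h, hT, mixtureWeight,
      Gamma_add_nat_eq_pochhammerSymbol_mul (x := k₂ + i) (by positivity), add_comm k₁ (i : ℝ),
      add_comm k₂ (i : ℝ)]
    push_cast
    simp only [div_eq_mul_inv, mul_inv]
    ring
  have hsum := hasSum_measureReal_bivariateGammaMeasure_prod hk₁ hk₂ hθ₁ hθ₂ hρ₀ hρ₁ hbiv
    ((gammaMeasure m₁ (m₁ / Ω₁)).prod (gammaMeasure m₂ (m₂ / Ω₂)))
    (measurableSet_outageEvent p σB σE)
  rw [← hevent, ← hout] at hsum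
  have hsumC := Complex.hasSum_ofReal.mpr hsum
  simp only [hterm] at hsumC
  -- A nonzero prefactor can be divided out, so summability passes to `T` itself.
  have hC : (((1 - ρ) ^ k₂ / (Real.Gamma m₁ * Real.Gamma m₂) : ℝ) : ℂ) ≠ 0 := by
    have := Real.Gamma_pos_of_pos hm₁
    have := Real.Gamma_pos_of_pos hm₂
    exact_mod_cast (by positivity :
      0 < (1 - ρ) ^ k₂ / (Real.Gamma m₁ * Real.Gamma m₂)).ne'
  refine ⟨hout, fun i j => ?_, (summable_mul_left_iff hC).mp hsumC.summable, ?_⟩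
  · rw [hA, hB]
    exact meijerGConverges_of_pos (by positivity) hm₁ hm₂ (by positivity) hzpos
  · rw [← tsum_mul_left, hsumC.tsum_eq]
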